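/- **Setting.** Fix a horizon $T\ge1$, a prompt $s_0$, discrete state spaces $\mathcal S_1,\dots,\mathcal S_T$ with prefix spaces $\mathcal S_{1:t}=\mathcal S_1\times\cdots\times\mathcal S_t$ ($\mathcal S_{1:0}=\{\varnothing\}$), a base model given by probability distributions $\pi_{\rm ref}(\cdot\mid s_0,s_{1:t})$ on $\mathcal S_{t+1}$, and a reward model $\hat V(s_0,s_{1:t})>0$. Put $Z_{t+1}(s_{1:t})=\mathbb E_{x\sim\pi_{\rm ref}(\cdot\mid s_0,s_{1:t})}[\hat V(s_0,(s_{1:t},x))]$, and let the target be $\tilde\pi_T(s_{1:T})\propto\prod_{t=1}^T\pi_{\rm ref}(s_t\mid s_0,s_{1:t-1})\cdot\hat V(s_0,s_{1:T})$. Let $\|\mu-\nu\|_{\rm TV}=\sup_A|\mu(A)-\nu(A)|$. **Assumptions.** For all $0\le t<T$ and all prefixes, (A1) $\hat V(s_0,s_{1:t})/\hat V(s_0,s_{1:t+1})\le L$ and $\hat V(s_0,s_{1:t+1})/\hat V(s_0,s_{1:t})\le L$, where $L\ge1$; (A2) $\hat V(s_0,s_{1:t})/Z_{t+1}(s_{1:t})\le1+\varepsilon$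 and $Z_{t+1}(s_{1:t})/\hat V(s_0,s_{1:t})\le1+\varepsilon$, where $\varepsilon>0$. **Subroutines.** $\widehat{\mathbb E}(s_{1:t})$ is the average of $\hat V(s_0,(s_{1:t},x_i))$ over $N_m$ fresh i.i.d. samples $x_i\sim\pi_{\rm ref}(\cdot\mid s_0,s_{1:t})$. $\mathrm{RS}(g,\mu,M,\delta')$: set $N=\lceil4M\log(4/\delta')\rceil$, let $\hat Z$ be the average of $g$ over $N$ i.i.d. samples of $\mu$; then up to $N$ times draw $z\sim\mu$ and return $z$ with probability $\min\{g(z)/(M\hat Z),1\}$; if nothing was returned, return a fresh $z\sim\mu$. **Algorithm** (rejection-based SP-gSMC with Metropolis–Hastings correction; parameters $H,N_m\ge1$, $M$, $\delta'$). For $h=1,\dots,H$: set $w=w'=1$; for $t=1,\dots,T$ draw $s_t$ by $\mathrm{RS}(\hat V(s_0,(s_{1:t-1},\cdot)),\pi_{\rm ref}(\cdot\mid s_0,s_{1:t-1}),M,\delta')$, multiply $w$ by $\hat V(s_0,s_{1:t})/\widehat{\mathbb E}(s_{1:t-1})$ and, if $h\ge2$, multiply $w'$ by $\hat V(s_0,s^{\rm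 acc}_{1:t})/\widehat{\mathbb E}(s^{\rm acc}_{1:t-1})$. If $h=1$, set $s^{\rm acc}_{1:T}=s_{1:T}$. If $h\ge2$, draw $\alpha\sim\mathrm{Unif}[0,1]$ and, if $\alpha<\frac{w'}{\hat V(s_0,s^{\rm acc}_{1:T})}\cdot\frac{\hat V(s_0,s_{1:T})}{w}$, set $s^{\rm acc}_{1:T}=s_{1:T}$. Output $s^{\rm acc}_{1:T}$. Its running time counts every random draw, every evaluation of $\hat V$ and every arithmetic operation as one unit. **Theorem.** For all constants $\kappa,c_0>0$ there are $C>0$ and $p\in\mathbb N$, depending only on $\kappa$ and $c_0$, such that for all $T\ge1$, $L\ge1$, $0<\varepsilon\le\kappa/T$, $0<\delta_{\rm TV}\le1$ and $0<\delta\le\min\{c_0\delta_{\rm TV},\tfrac12\}$ there are parameters $H,N_m\ge1$, $L(1+\varepsilon)<M\le CL$ and $0<\delta'<1$ with $\delta'\le C\delta/(T\log(1/\delta))$, depending only on $(\kappa,c_0,T,L,\varepsilon,\delta,\delta_{\rm TV})$, for which the following holds for all state spaces, base models, reward models and prompts that satisfy (A1) and (A2): every execution of the algorithm takes time at most $$C\,\frac{L\,T^3\log(1/\delta)}{\delta_{\rm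 TV}^2}\,\bigl(1+\log(T/\delta_{\rm TV})\bigr)^p ,$$ and there is an event $\mathcal E$ in the probability space of executions with $\mathbb P(\mathcal E)\ge1-\delta$ such that the law $\hat\pi_T|_{\mathcal E}$ of the output conditioned on $\mathcal E$ satisfies $\|\tilde\pi_T-\hat\pi_T|_{\mathcal E}\|_{\rm TV}\le\delta_{\rm TV}$. -/

import Mathlib

open scoped ENNReal

noncomputable section

/-! ### Randomised programs, their executions, laws and running times -/

/-- A randomised program returning a value of type `α`. It can draw a sample from a discrete
distribution (one unit of time) or spend one unit of time on a deterministic elementary operation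
(an evaluation of the reward model, or an arithmetic operation on real numbers). -/
inductive Prog (α : Type) : Type 1
  | ret (a : α) : Prog α
  | draw {Z : Type} (μ : PMF Z) (next : Z → Prog α) : Prog α
  | tick (next : Prog α) : Prog α

namespace Prog

/-- Sequential composition. -/
def bind {α β : Type} : Prog α → (α → Prog β) → Prog β
  | ret a, f => f a
  | draw μ next, f => draw μ (fun z => (next z).bind f)
  | tick next, f => tick (next.bind f)

instance : Monad Prog where
  pure := ret
  bind := bind

/-- The sample space of a program: an execution is the sequence of the outcomes of all its draws. -/
def Run {α : Type} : Prog α → Type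
  | ret _ => Unit
  | draw (Z := Z) _ next => (z : Z) × (next z).Run
  | tick next => next.Run

/-- The probability distribution on executions. -/
def law {α : Type} : (p : Prog α) → PMF p.Run
  | ret _ => PMF.pure ()
  | draw μ next => μ.bind fun z => (next z).law.map fun r => ⟨z, r⟩
  | tick next => next.law

/-- The value returned by an execution. -/
def output {α : Type} : (p : Prog α) → p.Run → α
  | ret a, _ => a
  | draw _ next, r => (next r.1).output r.2
  | tick next, r => next.output r

/-- The time taken by an execution. -/
def time {α : Type} : (p : Prog α) → p.Run → ℕ
  | ret _, _ => 0
  | draw _ next, r => (next r.1).time r.2 + 1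
  | tick next, r => next.time r + 1

/-- One draw from `μ`. -/
def sample {Z : Type} (μ : PMF Z) : Prog Z := draw μ ret

/-- Return `a`, at the cost of one unit of time. -/
def charge {α : Type} (a : α) : Prog α := tick (ret a)

/-- The Bernoulli distribution with parameter `min {r, 1}` (and `0` if `r < 0`). -/
def bernoulli (r : ℝ) : PMF Bool :=
  PMF.ofFintype
    (fun b => if b then min (ENNReal.ofReal r) 1 else 1 - min (ENNReal.ofReal r) 1)
    (by simp [add_tsub_cancel_of_le])

/-- A Bernoulli variable that is `true` with probability `min {r, 1}` (and `0` if `r < 0`);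
this is also the outcome of the test `α < r` for `α` uniform on `[0, 1]`. -/
def coin (r : ℝ) : Prog Bool := sample (bernoulli r)

/-- The law of the output of `p`, conditioned on the event `E` (of positive probability). -/
def outputGiven {α : Type} (p : Prog α) (E : Set p.Run) (hE : ∃ r ∈ E, r ∈ p.law.support) :
    PMF α :=
  (p.law.filter E hE).map p.output

end Prog

/-- The probability of the event `A`. -/
def prob {Ω : Type} (μ : PMF Ω) (A : Set Ω) : ℝ := (μ.toOuterMeasure A).toReal

/-- Total variation distance: `sup_A |μ(A) - ν(A)|`. -/
def tvDist {Ω : Type} (μ ν : PMF Ω) : ℝ := ⨆ A : Set Ω, |prob μ A - prob ν A|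

/-! ### Reasoning models -/

/-- The prefix space `S_{1:t}`, where `S_{1:0}` is a point and `S_{1:t+1} = S_{1:t} × S_{t+1}`. -/
def Prefix (S : ℕ → Type) : ℕ → Type
  | 0 => Unit
  | t + 1 => Prefix S t × S (t + 1)

/-- An autoregressive base model and a positive reward model on prefixes;
`S 0` is the prompt space and `S t` the reasoning state space at step `t ≥ 1`. -/
structure ReasoningModel (S : ℕ → Type) where
  /-- `ref s₀ t s` is the conditional law `π_ref(· | s₀, s_{1:t})` of the next step. -/
  ref : S 0 → (t : ℕ) → Prefix S t → PMF (S (t + 1))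
  /-- `V s₀ t s` is the score of the prefix `s = s_{1:t}`. -/
  V : S 0 → (t : ℕ) → Prefix S t → ℝ
  V_pos : ∀ s₀ t s, 0 < V s₀ t s

namespace ReasoningModel

variable {S : ℕ → Type} (m : ReasoningModel S) (s₀ : S 0)

/-- The law `π_ref(s_{1:t} | s₀)` of the prefix of length `t` under the base model. -/
def refPath : (t : ℕ) → PMF (Prefix S t)
  | 0 => PMF.pure ()
  | t + 1 => (refPath t).bind fun s => (m.ref s₀ t s).map fun x => (s, x)

/-- Reward model ratio bound with constant `L` for consecutive prefixes up to the horizon `T`. -/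
def RatioBound (T : ℕ) (L : ℝ) : Prop :=
  ∀ t < T, ∀ (s : Prefix S t) (x : S (t + 1)),
    m.V s₀ t s / m.V s₀ (t + 1) (s, x) ≤ L ∧ m.V s₀ (t + 1) (s, x) / m.V s₀ t s ≤ L

/-- The expected next score `E_{s_{t+1} ∼ π_ref(· | s₀, s_{1:t})} [V(s₀, s_{1:t+1})]`. -/
def nextValue (t : ℕ) (s : Prefix S t) : ℝ :=
  ∑' x, (m.ref s₀ t s x).toReal * m.V s₀ (t + 1) (s, x)

/-- Uniform Bellman error bound `ε` for all prefixes that can be extended within the horizon. -/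
def BellmanBound (T : ℕ) (ε : ℝ) : Prop :=
  ∀ t < T, ∀ s : Prefix S t,
    m.V s₀ t s / m.nextValue s₀ t s ≤ 1 + ε ∧ m.nextValue s₀ t s / m.V s₀ t s ≤ 1 + ε

/-- The unnormalised target `π_ref(s_{1:T} | s₀) V(s₀, s_{1:T})`. -/
def weight (T : ℕ) (s : Prefix S T) : ℝ≥0∞ :=
  m.refPath s₀ T s * ENNReal.ofReal (m.V s₀ T s)

theorem tsum_weight_ne_zero (T : ℕ) : ∑' s, m.weight s₀ T s ≠ 0 := by
  obtain ⟨s, hs⟩ := (m.refPath s₀ T).support_nonempty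
  intro h
  have h1 := ENNReal.tsum_eq_zero.1 h s
  rw [weight, mul_eq_zero] at h1
  rcases h1 with h1 | h1
  · exact (PMF.mem_support_iff _ _).1 hs h1
  · exact absurd (ENNReal.ofReal_eq_zero.1 h1) (not_le.2 (m.V_pos s₀ T s))

variable {m s₀}

theorem RatioBound.V_le {T : ℕ} {L : ℝ} (h : m.RatioBound s₀ T L) :
    ∀ t ≤ T, ∀ s : Prefix S t, m.V s₀ t s ≤ |L| ^ t * m.V s₀ 0 ()
  | 0, _, s => by simp; exact le_of_eq rfl
  | t + 1, ht, (s, x) => by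
    have h1 := (h t ht s x).2
    rw [div_le_iff₀ (m.V_pos _ _ _)] at h1
    calc m.V s₀ (t + 1) (s, x) ≤ L * m.V s₀ t s := h1
      _ ≤ |L| * m.V s₀ t s := mul_le_mul_of_nonneg_right (le_abs_self L) (m.V_pos _ _ _).le
      _ ≤ |L| * (|L| ^ t * m.V s₀ 0 ()) :=
        mul_le_mul_of_nonneg_left (RatioBound.V_le h t (by omega) s) (abs_nonneg L)
      _ = |L| ^ (t + 1) * m.V s₀ 0 () := by ring

theorem RatioBound.tsum_weight_ne_top {T : ℕ} {L : ℝ} (h : m.RatioBound s₀ T L) :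
    ∑' s, m.weight s₀ T s ≠ ∞ := by
  refine ne_top_of_le_ne_top (b := ENNReal.ofReal (|L| ^ T * m.V s₀ 0 ())) ENNReal.ofReal_ne_top ?_
  calc ∑' s, m.weight s₀ T s
      ≤ ∑' s, m.refPath s₀ T s * ENNReal.ofReal (|L| ^ T * m.V s₀ 0 ()) :=
        ENNReal.tsum_le_tsum fun s => by
          unfold weight
          gcongr
          exact h.V_le T le_rfl s
    _ = ENNReal.ofReal (|L| ^ T * m.V s₀ 0 ()) := by
        rw [ENNReal.tsum_mul_right, PMF.tsum_coe, one_mul]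

variable (m s₀)

/-- The reward-tilted target `π̃_T(s_{1:T} | s₀) ∝ π_ref(s_{1:T} | s₀) V(s₀, s_{1:T})`;
the ratio bound serves only to make the normalising constant finite. -/
def target (T : ℕ) {L : ℝ} (h : m.RatioBound s₀ T L) : PMF (Prefix S T) :=
  PMF.normalize (m.weight s₀ T) (m.tsum_weight_ne_zero s₀ T) h.tsum_weight_ne_top

end ReasoningModel

/-! ### The algorithm -/

/-- The sum of `n` evaluations of the score `g` at independent samples from `μ`. -/
def sumScores {Z : Type} (g : Z → ℝ) (μ : PMF Z) : ℕ → Prog ℝ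
  | 0 => pure 0
  | n + 1 => do
    let z ← Prog.sample μ
    let v ← Prog.charge (g z)
    let a ← sumScores g μ n
    Prog.charge (a + v)

/-- Empirical expectation of `g` from `n` independent samples of `μ`. -/
def empiricalMean {Z : Type} (g : Z → ℝ) (μ : PMF Z) (n : ℕ) : Prog ℝ := do
  let a ← sumScores g μ n
  Prog.charge (a / n)

/-- At most `n` accept-reject trials: a sample `z` of `μ` is accepted with probability
`min {g z / c, 1}`; if all of them fail, an unconditional sample of `μ` is returned. -/
def acceptReject {Z : Type} (g : Z → ℝ) (μ : PMF Z) (c : ℝ) : ℕ → Prog Z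
  | 0 => Prog.sample μ
  | n + 1 => do
    let z ← Prog.sample μ
    let v ← Prog.charge (g z)
    let q ← Prog.charge (v / c)
    let b ← Prog.coin q
    if b then pure z else acceptReject g μ c n

/-- Truncated rejection sampling from the tilt of `μ` by `g`, with threshold `M`, failure
probability `δ`, an empirical normaliser, and `N = ⌈4 M log (4 / δ)⌉` trials. -/
def rejectionSampling {Z : Type} (g : Z → ℝ) (μ : PMF Z) (M δ : ℝ) : Prog Z := do
  let N := ⌈4 * M * Real.log (4 / δ)⌉₊
  let Zhat ← empiricalMean g μ N
  let c ← Prog.charge (M * Zhat)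
  acceptReject g μ c N

namespace ReasoningModel

variable {S : ℕ → Type} (m : ReasoningModel S) (s₀ : S 0) (Nm : ℕ) (M δRS : ℝ)

/-- The estimate of the normaliser `E_{s'_{t+1} ∼ π_ref(· | s₀, s_{1:t})} [V(s₀, (s_{1:t}, s'_{t+1}))]`
from `Nm` fresh samples. -/
def estNormalizer (t : ℕ) (s : Prefix S t) : Prog ℝ :=
  empiricalMean (fun x => m.V s₀ (t + 1) (s, x)) (m.ref s₀ t s) Nm

/-- The inner loop up to step `t`. The argument is the prefix of length `t` of the currently
accepted trajectory (`none` as long as there is none). It returns the proposed prefix `s`, its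
cumulative weight `w = ∏ V(s_{1:k}) / Ê_k(s_{1:k-1})`, and the cumulative weight `w'` of the
accepted prefix (which stays `1` as long as there is none). -/
def innerLoop : (t : ℕ) → Option (Prefix S t) → Prog (Prefix S t × ℝ × ℝ)
  | 0, _ => pure ((), 1, 1)
  | t + 1, acc => do
    let (s, w, w') ← innerLoop t (acc.map Prod.fst)
    let x ← rejectionSampling (fun y => m.V s₀ (t + 1) (s, y)) (m.ref s₀ t s) M δRS
    let v ← Prog.charge (m.V s₀ (t + 1) (s, x))
    let z ← m.estNormalizer s₀ Nm t s
    let f ← Prog.charge (v / z)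
    let wNew ← Prog.charge (w * f)
    match acc with
    | none => pure ((s, x), wNew, w')
    | some (a, y) => do
      let v' ← Prog.charge (m.V s₀ (t + 1) (a, y))
      let z' ← m.estNormalizer s₀ Nm t a
      let f' ← Prog.charge (v' / z')
      let wNew' ← Prog.charge (w' * f')
      pure ((s, x), wNew, wNew')

/-- The accepted trajectory after the iterations `h = 1, …, k + 1` of the outer loop: the first
proposal is accepted, and each later one passes a Metropolis-Hastings test with the estimated
ratio `(w' / V(acc)) * (V(s) / w)`. -/
def outerLoop (T : ℕ) : (k : ℕ) → Prog (Prefix S T)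
  | 0 => do
    let (s, _, _) ← m.innerLoop s₀ Nm M δRS T none
    pure s
  | k + 1 => do
    let acc ← outerLoop T k
    let (s, w, w') ← m.innerLoop s₀ Nm M δRS T (some acc)
    let vAcc ← Prog.charge (m.V s₀ T acc)
    let v ← Prog.charge (m.V s₀ T s)
    let q₁ ← Prog.charge (w' / vAcc)
    let q₂ ← Prog.charge (v / w)
    let q ← Prog.charge (q₁ * q₂)
    let b ← Prog.coin q
    if b then pure s else pure acc

/-- Rejection-based single-particle guided SMC with Metropolis-Hastings correction, with
`H ≥ 1` iterations of the outer loop. -/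
def spgSMCMH (T H : ℕ) : Prog (Prefix S T) := m.outerLoop s₀ Nm M δRS T (H - 1)

end ReasoningModel

end

/-! With exact tilting and exact normalisers, one round of the outer loop is a Metropolis-Hastings
step with an independent proposal, reversible for the target (`bind_mhKernel_target`). The density
of the target against the proposal telescopes: the scores cancel and only one-step Bellman factors
remain (`importance_bounds`). Two values of this density therefore differ by a factor at most `(1 +
ε) ^ (2 * T)`, hence at most `exp (2 * κ)`. Every proposal is accepted with probability at least `β
= exp (-(2 * κ))`, and the exact chain contracts total variation by `1 - β` per step
(`Close.contract`).

The real step differs from the exact one in two ways. Rejection sampling costs `δRS` per token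
(`close_rejectionSampling`). The estimated weights change the acceptance probability by at most
their logarithmic error (`close_bernoulli`), which adds up over the tokens. Only its mean matters,
since total variation averages over the randomness of the estimates (`Close.bind_right`). A
normaliser estimate has mean relative error `O(√(B / Nm))` with `B = L * (1 + ε)`, as scores bounded
by `B` times their mean have relative variance at most `B`.

If `η` bounds the error of one step, contraction limits the total to `η / β + (1 - β) ^ k`
(`close_outerLoop`). Taking `Nm` of order `L * T ^ 2 / δTV ^ 2` and `k` of order `log (2 / δTV)`
suffices, and the time is of order `k * T * (N + Nm)`, where `N` is the number of trials. Working
with means makes the bound hold unconditionally, so no exceptional event is removed. -/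

/-! ### Expectations and closeness of discrete distributions -/

/-- The expectation of a nonnegative function under a discrete distribution. -/
noncomputable def expect {Ω : Type} (μ : PMF Ω) (f : Ω → ℝ≥0∞) : ℝ≥0∞ := ∑' x, μ x * f x

section Expect

variable {Ω Ω' : Type}

theorem expect_pure (a : Ω) (f : Ω → ℝ≥0∞) : expect (PMF.pure a) f = f a := by
  unfold expect
  rw [tsum_eq_single a]
  · simp
  · intro b hb; simp [PMF.pure_apply, hb]

theorem expect_bind (μ : PMF Ω) (k : Ω → PMF Ω') (f : Ω' → ℝ≥0∞) :
    expect (μ.bind k) f = expect μ fun x => expect (k x) f := by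
  simp only [expect, PMF.bind_apply, ← ENNReal.tsum_mul_right, ← ENNReal.tsum_mul_left]
  rw [ENNReal.tsum_comm]
  simp only [mul_assoc]

theorem expect_map (μ : PMF Ω) (g : Ω → Ω') (f : Ω' → ℝ≥0∞) :
    expect (μ.map g) f = expect μ fun x => f (g x) := by
  rw [← PMF.bind_pure_comp, expect_bind]
  simp only [Function.comp, expect_pure]

theorem expect_mono (μ : PMF Ω) {f g : Ω → ℝ≥0∞} (h : ∀ x, f x ≤ g x) :
    expect μ f ≤ expect μ g :=
  ENNReal.tsum_le_tsum fun x => mul_le_mul_right (h x) _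

theorem expect_const (μ : PMF Ω) (c : ℝ≥0∞) : expect μ (fun _ => c) = c := by
  rw [expect, ENNReal.tsum_mul_right, PMF.tsum_coe, one_mul]

theorem expect_add (μ : PMF Ω) (f g : Ω → ℝ≥0∞) :
    expect μ (fun x => f x + g x) = expect μ f + expect μ g := by
  simp only [expect, mul_add, ENNReal.tsum_add]

theorem expect_const_mul (μ : PMF Ω) (c : ℝ≥0∞) (f : Ω → ℝ≥0∞) :
    expect μ (fun x => c * f x) = c * expect μ f := by
  simp only [expect, ← ENNReal.tsum_mul_left]
  exact tsum_congr fun x => by ring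

theorem expect_mul_const (μ : PMF Ω) (c : ℝ≥0∞) (f : Ω → ℝ≥0∞) :
    expect μ (fun x => f x * c) = expect μ f * c := by
  simp only [expect, ← ENNReal.tsum_mul_right, mul_assoc]

theorem expect_le_of_le (μ : PMF Ω) {f : Ω → ℝ≥0∞} {c : ℝ≥0∞} (h : ∀ x, f x ≤ c) :
    expect μ f ≤ c :=
  (expect_mono μ h).trans_eq (expect_const μ c)

theorem expect_one_sub (μ : PMF Ω) {f : Ω → ℝ≥0∞} (h : ∀ x, f x ≤ 1) :
    expect μ f + expect μ (fun x => 1 - f x) = 1 := by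
  simp only [← expect_add, add_tsub_cancel_of_le (h _), expect_const]

theorem expect_comm (μ : PMF Ω) (ν : PMF Ω') (f : Ω → Ω' → ℝ≥0∞) :
    expect μ (fun x => expect ν (f x)) = expect ν (fun y => expect μ fun x => f x y) := by
  simp only [expect, ← ENNReal.tsum_mul_left]
  rw [ENNReal.tsum_comm]
  exact tsum_congr fun y => tsum_congr fun x => by ring

theorem expect_indicator (μ : PMF Ω) (A : Set Ω) :
    expect μ (A.indicator 1) = μ.toOuterMeasure A := by
  rw [PMF.toOuterMeasure_apply, expect]
  refine tsum_congr fun x => ?_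
  by_cases h : x ∈ A <;> simp [h]

/-- `μ` and `ν` are at total variation distance at most `c`. -/
def Close (c : ℝ≥0∞) (μ ν : PMF Ω) : Prop :=
  ∀ f : Ω → ℝ≥0∞, (∀ x, f x ≤ 1) → expect μ f ≤ expect ν f + c

theorem Close.refl (μ : PMF Ω) : Close 0 μ μ := fun f _ => by simp

theorem Close.mono {c c' : ℝ≥0∞} {μ ν : PMF Ω} (h : Close c μ ν) (hc : c ≤ c') :
    Close c' μ ν := fun f hf => (h f hf).trans (by gcongr)

theorem Close.of_one_le {c : ℝ≥0∞} (hc : 1 ≤ c) (μ ν : PMF Ω) : Close c μ ν := fun _ hf =>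
  (expect_le_of_le μ hf).trans (hc.trans le_add_self)

theorem Close.trans {c d : ℝ≥0∞} {μ ν ρ : PMF Ω} (h : Close c μ ν) (h' : Close d ν ρ) :
    Close (c + d) μ ρ := fun f hf => by
  calc expect μ f ≤ expect ν f + c := h f hf
    _ ≤ expect ρ f + d + c := by gcongr; exact h' f hf
    _ = expect ρ f + (c + d) := by ring

/-- The complement `1 - f` is again a test function, and both laws have mass one. -/
theorem Close.symm {c : ℝ≥0∞} {μ ν : PMF Ω} (h : Close c μ ν) : Close c ν μ := fun f hf => by
  have h1 := h (fun x => 1 - f x) fun x => tsub_le_self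
  have hμ := expect_one_sub μ hf
  have hν := expect_one_sub ν hf
  have hfin : expect ν (fun x => 1 - f x) ≠ ∞ :=
    ne_top_of_le_ne_top ENNReal.one_ne_top (expect_le_of_le ν fun x => tsub_le_self)
  refine (ENNReal.add_le_add_iff_right hfin).1 ?_
  calc _ = expect μ f + expect μ (fun x => 1 - f x) := by rw [hμ, hν]
    _ ≤ expect μ f + (expect ν (fun x => 1 - f x) + c) := by gcongr
    _ = _ := by ring

/-- Closeness controls the expectation of functions with an arbitrary upper bound. -/
theorem Close.expect_le {c : ℝ≥0∞} {μ ν : PMF Ω} (h : Close c μ ν) {b : ℝ≥0∞} (hb : b ≠ ∞)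
    {f : Ω → ℝ≥0∞} (hf : ∀ x, f x ≤ b) : expect μ f ≤ expect ν f + b * c := by
  rcases eq_or_ne b 0 with rfl | hb0
  · rw [show f = fun _ => 0 from funext fun x => by simpa using hf x]
    simp [expect_const]
  · have h1 := h (fun x => b⁻¹ * f x) fun x => by
      rw [← ENNReal.inv_mul_cancel hb0 hb]; gcongr; exact hf x
    rw [expect_const_mul, expect_const_mul] at h1
    calc expect μ f = b * (b⁻¹ * expect μ f) := by
          rw [← mul_assoc, ENNReal.mul_inv_cancel hb0 hb, one_mul]
      _ ≤ b * (b⁻¹ * expect ν f + c) := by gcongr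
      _ = _ := by rw [mul_add, ← mul_assoc, ENNReal.mul_inv_cancel hb0 hb, one_mul]

theorem Close.bind_left {c : ℝ≥0∞} {μ ν : PMF Ω} (h : Close c μ ν) (k : Ω → PMF Ω') :
    Close c (μ.bind k) (ν.bind k) := fun f hf => by
  rw [expect_bind, expect_bind]
  exact h _ fun x => expect_le_of_le _ hf

/-- The error may depend on the point and is averaged. Random estimation errors thus enter through
their means, without a high-probability event. -/
theorem Close.bind_right (μ : PMF Ω) {k k' : Ω → PMF Ω'} {c : Ω → ℝ≥0∞}
    (h : ∀ x, Close (c x) (k x) (k' x)) :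
    Close (expect μ c) (μ.bind k) (μ.bind k') := fun f hf => by
  rw [expect_bind, expect_bind, ← expect_add]
  exact expect_mono _ fun x => h x f hf

theorem Close.bind {c d : ℝ≥0∞} {μ ν : PMF Ω} {k k' : Ω → PMF Ω'} (h : Close c μ ν)
    (h' : ∀ x, Close d (k x) (k' x)) : Close (c + d) (μ.bind k) (ν.bind k') :=
  (h.bind_left k).trans ((Close.bind_right ν h').mono (expect_const ν d).le)

/-- Doeblin contraction: a kernel that dominates `β • ν` at every point contracts total variation
distance by the factor `1 - β`. -/
theorem Close.contract {c β : ℝ≥0∞} {μ μ' : PMF Ω} {k : Ω → PMF Ω'} {ν : PMF Ω'}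
    (hk : ∀ x y, β * ν y ≤ k x y) (h : Close c μ μ') :
    Close ((1 - β) * c) (μ.bind k) (μ'.bind k) := fun f hf => by
  -- Split each `k x` into the common part `β • ν` and a remainder of mass `1 - β`. The common part
  -- contributes equally from both starting laws, so only the remainder sees their difference.
  have key : ∀ x, expect (k x) f = β * expect ν f + ∑' y, (k x y - β * ν y) * f y := by
    intro x
    simp only [expect, ← ENNReal.tsum_mul_left]
    rw [← ENNReal.tsum_add]
    refine tsum_congr fun y => ?_
    rw [← mul_assoc, ← add_mul, add_tsub_cancel_of_le (hk x y)]
  have hbd : ∀ x, ∑' y, (k x y - β * ν y) * f y ≤ 1 - β := by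
    intro x
    have hs : ∑' y, β * ν y = β := by rw [ENNReal.tsum_mul_left, PMF.tsum_coe, mul_one]
    have hβ : β ≤ 1 := by
      rw [← hs, ← PMF.tsum_coe (k x)]; exact ENNReal.tsum_le_tsum (hk x)
    calc _ ≤ ∑' y, (k x y - β * ν y) := ENNReal.tsum_le_tsum fun y =>
          (mul_le_mul_right (hf y) _).trans_eq (mul_one _)
      _ = 1 - β := by
        refine ENNReal.eq_sub_of_add_eq (ne_top_of_le_ne_top ENNReal.one_ne_top hβ) ?_
        rw [← PMF.tsum_coe (k x)]
        nth_rw 2 [← hs]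
        rw [← ENNReal.tsum_add]
        exact tsum_congr fun y => tsub_add_cancel_of_le (hk x y)
  rw [expect_bind, expect_bind]
  simp only [key]
  rw [expect_add, expect_add, expect_const, expect_const, add_assoc]
  gcongr
  exact h.expect_le (ne_top_of_le_ne_top ENNReal.one_ne_top tsub_le_self) hbd

theorem Close.tvDist_le {c : ℝ} (hc : 0 ≤ c) {μ ν : PMF Ω} (h : Close (ENNReal.ofReal c) μ ν) :
    tvDist μ ν ≤ c := by
  have key : ∀ {μ ν : PMF Ω}, Close (ENNReal.ofReal c) μ ν → ∀ A : Set Ω,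
      prob μ A ≤ prob ν A + c := by
    intro μ ν h A
    have h1 := h (A.indicator 1) fun x => Set.indicator_le_self' (fun _ _ => zero_le) x
    rw [expect_indicator, expect_indicator] at h1
    have hfin : ν.toOuterMeasure A ≠ ∞ := by
      rw [← expect_indicator]
      exact ne_top_of_le_ne_top ENNReal.one_ne_top
        (expect_le_of_le ν fun x => Set.indicator_le_self' (fun _ _ => zero_le) x)
    have h2 := ENNReal.toReal_mono (by finiteness) h1
    rwa [ENNReal.toReal_add hfin ENNReal.ofReal_ne_top, ENNReal.toReal_ofReal hc] at h2
  refine ciSup_le fun A => abs_sub_le_iff.2 ⟨?_, ?_⟩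
  · linarith [key h A]
  · linarith [key h.symm A]

end Expect

/-! ### The law of the output and the running time of a program -/

namespace Prog

variable {α β : Type}

/-- The law of the output of a program. -/
noncomputable def dist (p : Prog α) : PMF α := p.law.map p.output

theorem dist_ret (a : α) : (ret a).dist = PMF.pure a := PMF.pure_map _ _

theorem dist_pure (a : α) : (pure a : Prog α).dist = PMF.pure a := dist_ret a

theorem dist_draw {Z : Type} (μ : PMF Z) (next : Z → Prog α) :
    (draw μ next).dist = μ.bind fun z => (next z).dist := by
  change (μ.bind fun z => (next z).law.map fun r => (⟨z, r⟩ : (z : Z) × (next z).Run)).map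
    (fun r : (z : Z) × (next z).Run => (next r.1).output r.2) = _
  rw [PMF.map_bind]
  simp only [PMF.map_comp]
  rfl

theorem dist_bind (p : Prog α) (f : α → Prog β) :
    (p >>= f).dist = p.dist.bind fun a => (f a).dist := by
  change (p.bind f).dist = _
  induction p with
  | ret a => rw [Prog.bind, dist_ret, PMF.pure_bind]
  | draw μ next ih =>
    rw [Prog.bind, dist_draw, dist_draw, PMF.bind_bind]
    congr 1; ext1 z; exact ih z
  | tick next ih => exact ih

theorem dist_sample {Z : Type} (μ : PMF Z) : (sample μ).dist = μ := by
  rw [sample, dist_draw]; simp only [dist_ret, PMF.bind_pure]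

theorem dist_charge (a : α) : (charge a).dist = PMF.pure a := dist_ret a

theorem dist_coin (r : ℝ) : (coin r).dist = bernoulli r := dist_sample _

theorem outputGiven_univ (p : Prog α) (hE : ∃ r ∈ Set.univ, r ∈ p.law.support) :
    p.outputGiven Set.univ hE = p.dist := by
  have : p.law.filter Set.univ hE = p.law := by
    ext r; simp [PMF.filter_apply, PMF.tsum_coe]
  rw [outputGiven, this, dist]

/-- Every execution of `p` takes time at most `n`. -/
def TimeLE (p : Prog α) (n : ℕ) : Prop := ∀ r : p.Run, p.time r ≤ n

/-- A worst-case bound needs only some pair of runs with the right total time; `a` need not be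
identified as the output of `r₁`. -/
theorem exists_time_bind (p : Prog α) (f : α → Prog β) (r : (p.bind f).Run) :
    ∃ (r₁ : p.Run) (a : α) (r₂ : (f a).Run), (p.bind f).time r = p.time r₁ + (f a).time r₂ := by
  induction p with
  | ret a => exact ⟨(), a, r, (Nat.zero_add _).symm⟩
  | draw μ next ih =>
    obtain ⟨r₁, a, r₂, h⟩ := ih r.1 r.2
    refine ⟨⟨r.1, r₁⟩, a, r₂, ?_⟩
    change ((next r.1).bind f).time r.2 + 1 = (next r.1).time r₁ + 1 + (f a).time r₂
    omega
  | tick next ih =>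
    obtain ⟨r₁, a, r₂, h⟩ := ih r
    refine ⟨r₁, a, r₂, ?_⟩
    change (next.bind f).time r + 1 = next.time r₁ + 1 + (f a).time r₂
    omega

theorem TimeLE.bind {p : Prog α} {f : α → Prog β} {m n : ℕ} (hp : p.TimeLE m)
    (hf : ∀ a, (f a).TimeLE n) : (p >>= f).TimeLE (m + n) := fun r => by
  obtain ⟨r₁, a, r₂, h⟩ := exists_time_bind p f r
  exact h.trans_le (Nat.add_le_add (hp r₁) (hf a r₂))

theorem TimeLE.mono {p : Prog α} {m n : ℕ} (hp : p.TimeLE m) (h : m ≤ n) : p.TimeLE n :=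
  fun r => (hp r).trans h

theorem timeLE_pure (a : α) : (pure a : Prog α).TimeLE 0 := fun _ => le_rfl

theorem timeLE_charge (a : α) : (charge a).TimeLE 1 := fun _ => le_rfl

theorem timeLE_sample {Z : Type} (μ : PMF Z) : (sample μ).TimeLE 1 := fun _ => le_rfl

theorem timeLE_coin (r : ℝ) : (coin r).TimeLE 1 := timeLE_sample _

end Prog

/-! ### Worst-case running times of the subroutines and loops -/

section Time

open Prog

variable {Z : Type} (g : Z → ℝ) (μ : PMF Z)

theorem timeLE_sumScores (n : ℕ) : (sumScores g μ n).TimeLE (3 * n) := by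
  induction n with
  | zero => exact timeLE_pure _
  | succ n ih =>
    refine TimeLE.mono (m := 1 + (1 + (3 * n + 1))) ?_ (by omega)
    exact (timeLE_sample μ).bind fun z => (timeLE_charge _).bind fun v =>
      ih.bind fun a => timeLE_charge _

theorem timeLE_empiricalMean (n : ℕ) : (empiricalMean g μ n).TimeLE (3 * n + 1) :=
  (timeLE_sumScores g μ n).bind fun _ => timeLE_charge _

theorem timeLE_acceptReject (c : ℝ) (n : ℕ) : (acceptReject g μ c n).TimeLE (4 * n + 1) := by
  induction n with
  | zero => exact timeLE_sample _
  | succ n ih =>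
    refine TimeLE.mono (m := 1 + (1 + (1 + (1 + (4 * n + 1))))) ?_ (by omega)
    refine (timeLE_sample μ).bind fun z => (timeLE_charge _).bind fun v =>
      (timeLE_charge _).bind fun q => (timeLE_coin _).bind fun b => ?_
    cases b
    · exact ih
    · exact (timeLE_pure _).mono (Nat.zero_le _)

theorem timeLE_rejectionSampling (M δ : ℝ) :
    (rejectionSampling g μ M δ).TimeLE (7 * ⌈4 * M * Real.log (4 / δ)⌉₊ + 3) := by
  refine TimeLE.mono (m := ?n) ?h (le_of_eq ?e)
  case h =>
    exact (timeLE_empiricalMean g μ _).bind fun _ => (timeLE_charge _).bind fun _ =>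
      timeLE_acceptReject g μ _ _
  case e => ring

namespace ReasoningModel

variable {S : ℕ → Type} (m : ReasoningModel S) (s₀ : S 0) (Nm : ℕ) (M δRS : ℝ)

theorem timeLE_innerLoop (t : ℕ) (acc : Option (Prefix S t)) :
    (m.innerLoop s₀ Nm M δRS t acc).TimeLE
      (t * (7 * ⌈4 * M * Real.log (4 / δRS)⌉₊ + 6 * Nm + 12)) := by
  induction t with
  | zero => exact (timeLE_pure _).mono (Nat.zero_le _)
  | succ t ih =>
    refine TimeLE.mono (m := ?n) ?h (le_of_eq ?e)
    case h =>
      refine (ih _).bind fun x => (timeLE_rejectionSampling _ _ M δRS).bind fun _ =>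
        (timeLE_charge _).bind fun _ => (timeLE_empiricalMean _ _ Nm).bind fun _ =>
        (timeLE_charge _).bind fun _ => (timeLE_charge _).bind
          (n := 1 + (3 * Nm + 1 + (1 + (1 + 1)))) fun _ => ?_
      rcases acc with _ | ⟨a, y⟩
      · exact (timeLE_pure _).mono (Nat.zero_le _)
      · exact (timeLE_charge _).bind fun _ => (timeLE_empiricalMean _ _ Nm).bind fun _ =>
          (timeLE_charge _).bind fun _ => (timeLE_charge _).bind fun _ =>
          (timeLE_pure _).mono (Nat.zero_le _)
    case e => ring

theorem timeLE_outerLoop (T k : ℕ) :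
    (m.outerLoop s₀ Nm M δRS T k).TimeLE
      ((k + 1) * (T * (7 * ⌈4 * M * Real.log (4 / δRS)⌉₊ + 6 * Nm + 12) + 6)) := by
  induction k with
  | zero =>
    refine TimeLE.mono ((m.timeLE_innerLoop s₀ Nm M δRS T none).bind fun _ => timeLE_pure _) ?_
    omega
  | succ k ih =>
    refine TimeLE.mono (m := ?n) ?h (le_of_eq ?e)
    case h =>
      refine ih.bind fun acc => (m.timeLE_innerLoop s₀ Nm M δRS T _).bind fun _ =>
        (timeLE_charge _).bind fun _ => (timeLE_charge _).bind fun _ =>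
        (timeLE_charge _).bind fun _ => (timeLE_charge _).bind fun _ =>
        (timeLE_charge _).bind fun _ => (timeLE_coin _).bind (n := 0) fun b => ?_
      cases b <;> exact timeLE_pure _
    case e => ring

end ReasoningModel

end Time

/-! ### Empirical means of bounded scores -/

section Scores

variable {Z : Type}

/-- The scores `g` are positive with expectation `v` under `μ`, and bounded by `B * v`. -/
structure ScoreBound (g : Z → ℝ) (μ : PMF Z) (v B : ℝ) : Prop where
  v_pos : 0 < v
  pos : ∀ z, 0 < g z
  le : ∀ z, g z ≤ B * v
  mean : expect μ (fun z => ENNReal.ofReal (g z)) = ENNReal.ofReal v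

theorem expect_bernoulli (r : ℝ) (f : Bool → ℝ≥0∞) :
    expect (Prog.bernoulli r) f =
      min (ENNReal.ofReal r) 1 * f true + (1 - min (ENNReal.ofReal r) 1) * f false := by
  simp [expect, Prog.bernoulli, PMF.ofFintype_apply]

namespace ScoreBound

variable {g : Z → ℝ} {μ : PMF Z} {v B : ℝ}

theorem hasSum (h : ScoreBound g μ v B) : HasSum (fun z => (μ z).toReal * g z) v := by
  have h1 : ∑' z, μ z * ENNReal.ofReal (g z) ≠ ∞ := by
    have := h.mean; unfold expect at this; rw [this]; exact ENNReal.ofReal_ne_top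
  have h2 := ENNReal.hasSum_toReal h1
  rw [← ENNReal.tsum_toReal_eq (fun z => ENNReal.ne_top_of_tsum_ne_top h1 z)] at h2
  have h3 : (∑' z, μ z * ENNReal.ofReal (g z)).toReal = v := by
    have := h.mean; unfold expect at this; rw [this, ENNReal.toReal_ofReal h.v_pos.le]
  rw [h3] at h2
  convert h2 using 2 with z
  rw [ENNReal.toReal_mul, ENNReal.toReal_ofReal (h.pos z).le]

theorem one_le (h : ScoreBound g μ v B) : 1 ≤ B := by
  have h1 : ENNReal.ofReal v ≤ ENNReal.ofReal (B * v) := by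
    rw [← h.mean]
    exact expect_le_of_le μ fun z => ENNReal.ofReal_le_ofReal (h.le z)
  by_contra! hB
  have h2 : 0 < B * v := by
    obtain ⟨z, _⟩ := μ.support_nonempty
    exact (h.pos z).trans_le (h.le z)
  rw [ENNReal.ofReal_le_ofReal_iff h2.le] at h1
  nlinarith [h.v_pos]

theorem expect_affine (h : ScoreBound g μ v B) {a b : ℝ} (hab : ∀ z, 0 ≤ a + b * g z) :
    expect μ (fun z => ENNReal.ofReal (a + b * g z)) = ENNReal.ofReal (a + b * v) := by
  have hμ : HasSum (fun z => (μ z).toReal) 1 := by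
    have h1 := ENNReal.hasSum_toReal μ.tsum_coe_ne_top
    rwa [← ENNReal.tsum_toReal_eq (fun z => μ.apply_ne_top z), μ.tsum_coe,
      ENNReal.toReal_one] at h1
  have hs : HasSum (fun z => (μ z).toReal * (a + b * g z)) (a + b * v) := by
    have h1 := (hμ.mul_left a).add (h.hasSum.mul_left b)
    rw [mul_one] at h1
    have h2 : (fun z => (μ z).toReal * (a + b * g z)) =
        fun z => a * (μ z).toReal + b * ((μ z).toReal * g z) := funext fun z => by ring
    rw [h2]
    exact h1
  rw [← hs.tsum_eq, ENNReal.ofReal_tsum_of_nonneg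
    (fun z => mul_nonneg ENNReal.toReal_nonneg (hab z)) hs.summable, expect]
  refine tsum_congr fun z => ?_
  rw [ENNReal.ofReal_mul ENNReal.toReal_nonneg, ENNReal.ofReal_toReal (μ.apply_ne_top z)]

/-- For `|x| ≤ 1`, `exp x ≤ 1 + x + x ^ 2`. Since `0 ≤ g / v ≤ B`, the square is at most `B * (g /
v)`, so the bound is affine in `g` and its mean is known. The factor `B` in place of `B ^ 2` is what
keeps the sample size linear in `L`. -/
theorem expect_exp_le (h : ScoreBound g μ v B) {θ : ℝ} (hθ : |θ| * B ≤ 1) :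
    expect μ (fun z => ENNReal.ofReal (Real.exp (θ * (g z / v)))) ≤
      ENNReal.ofReal (Real.exp (θ + θ ^ 2 * B)) := by
  have hv := h.v_pos
  have key : ∀ z, Real.exp (θ * (g z / v)) ≤ 1 + (θ + θ ^ 2 * B) / v * g z := by
    intro z
    have hx0 : 0 ≤ g z / v := (div_pos (h.pos z) hv).le
    have hxB : g z / v ≤ B := by rw [div_le_iff₀ hv]; exact h.le z
    have h1 : |θ * (g z / v)| ≤ 1 := by
      rw [abs_mul, abs_of_nonneg hx0]
      exact (mul_le_mul_of_nonneg_left hxB (abs_nonneg θ)).trans hθ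
    have h2 := (abs_le.1 (Real.abs_exp_sub_one_sub_id_le h1)).2
    have h3 : (θ * (g z / v)) ^ 2 ≤ θ ^ 2 * B * (g z / v) := by
      have : 0 ≤ θ ^ 2 * (g z / v) * (B - g z / v) :=
        mul_nonneg (mul_nonneg (sq_nonneg θ) hx0) (sub_nonneg.2 hxB)
      linarith
    calc _ ≤ 1 + θ * (g z / v) + θ ^ 2 * B * (g z / v) := by linarith
      _ = _ := by ring
  refine (expect_mono μ fun z => ENNReal.ofReal_le_ofReal (key z)).trans ?_
  rw [h.expect_affine fun z => (Real.exp_pos _).le.trans (key z), div_mul_cancel₀ _ hv.ne']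
  refine ENNReal.ofReal_le_ofReal ?_
  linarith [Real.add_one_le_exp (θ + θ ^ 2 * B)]

theorem expect_exp_sumScores_le (h : ScoreBound g μ v B) {θ : ℝ} (hθ : |θ| * B ≤ 1) (n : ℕ) :
    expect (sumScores g μ n).dist (fun a => ENNReal.ofReal (Real.exp (θ * (a / v)))) ≤
      ENNReal.ofReal (Real.exp (n * (θ + θ ^ 2 * B))) := by
  induction n with
  | zero => simp [sumScores, Prog.dist_pure, expect_pure]
  | succ n ih =>
    have h1 : expect (sumScores g μ (n + 1)).dist
        (fun a => ENNReal.ofReal (Real.exp (θ * (a / v)))) =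
        expect μ (fun z => ENNReal.ofReal (Real.exp (θ * (g z / v)))) *
        expect (sumScores g μ n).dist (fun a => ENNReal.ofReal (Real.exp (θ * (a / v)))) := by
      simp only [sumScores, Prog.dist_bind, Prog.dist_sample, Prog.dist_charge, PMF.pure_bind,
        expect_bind, expect_pure, ← expect_mul_const]
      refine congrArg _ (funext fun z => ?_)
      rw [← expect_const_mul]
      refine congrArg _ (funext fun a => ?_)
      rw [← ENNReal.ofReal_mul (Real.exp_pos _).le, ← Real.exp_add]
      congr 2; ring
    rw [h1]
    refine (mul_le_mul' (h.expect_exp_le hθ) ih).trans_eq ?_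
    rw [← ENNReal.ofReal_mul (Real.exp_pos _).le, ← Real.exp_add]
    congr 2; push_cast; ring

theorem dist_empiricalMean (g : Z → ℝ) (μ : PMF Z) (n : ℕ) :
    (empiricalMean g μ n).dist = (sumScores g μ n).dist.map fun a : ℝ => a / n := by
  simp only [empiricalMean, Prog.dist_bind, Prog.dist_charge]
  exact PMF.bind_pure_comp _ _

/-- The expectation of `exp (θ n (Ẑ / v - 1))` for the empirical mean `Ẑ`. -/
theorem expect_exp_empiricalMean_le (h : ScoreBound g μ v B) {θ : ℝ} (hθ : |θ| * B ≤ 1) {n : ℕ}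
    (hn : 0 < n) (s : ℝ) :
    expect (empiricalMean g μ n).dist
      (fun a => ENNReal.ofReal (Real.exp (θ * n * (a / v - s)))) ≤
      ENNReal.ofReal (Real.exp (n * (θ + θ ^ 2 * B) - θ * n * s)) := by
  have hn' : (n : ℝ) ≠ 0 := by positivity
  rw [dist_empiricalMean, expect_map]
  calc _ = expect (sumScores g μ n).dist (fun a => ENNReal.ofReal (Real.exp (θ * (a / v)))) *
        ENNReal.ofReal (Real.exp (-(θ * n * s))) := by
        rw [← expect_mul_const]
        refine congrArg _ (funext fun a => ?_)
        rw [← ENNReal.ofReal_mul (Real.exp_pos _).le, ← Real.exp_add]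
        congr 2
        field_simp
        ring
    _ ≤ ENNReal.ofReal (Real.exp (n * (θ + θ ^ 2 * B))) *
        ENNReal.ofReal (Real.exp (-(θ * n * s))) := by
        gcongr; exact h.expect_exp_sumScores_le hθ n
    _ = _ := by
        rw [← ENNReal.ofReal_mul (Real.exp_pos _).le, ← Real.exp_add, sub_eq_add_neg]

/-- The mean absolute relative error of the empirical mean. -/
theorem expect_abs_empiricalMean_le (h : ScoreBound g μ v B) {n : ℕ} (hn : B ≤ n) :
    expect (empiricalMean g μ n).dist (fun a => ENNReal.ofReal |a / v - 1|) ≤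
      ENNReal.ofReal (6 * √(B / n)) := by
  have hB : 0 < B := one_pos.trans_le h.one_le
  have hn' : (0 : ℝ) < n := hB.trans_le hn
  have hn0 : 0 < n := by exact_mod_cast hn'
  -- With `θ = ± τ / n` the centred exponent `n * θ ^ 2 * B` equals `1`, and `|θ| * B ≤ 1` amounts
  -- to `B ≤ n`. Since `τ * |y| ≤ exp (τ * y) + exp (-(τ * y))`, the mean error is at most `2 * exp
  -- 1 / τ ≤ 6 / τ`.
  set τ := √(n / B) with hτ
  have hτ0 : 0 < τ := Real.sqrt_pos.2 (by positivity)
  have hτ2 : τ ^ 2 = n / B := Real.sq_sqrt (by positivity)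
  have hinv : √(B / n) = τ⁻¹ := by rw [hτ, ← Real.sqrt_inv, inv_div]
  have hτn : τ * B ≤ n := by
    have h1 : (1 : ℝ) ≤ τ := Real.one_le_sqrt.2 ((one_le_div hB).2 hn)
    have h2 : τ ^ 2 * B = n := by rw [hτ2]; field_simp
    nlinarith
  have hθ : |τ / n| * B ≤ 1 := by
    rw [abs_of_pos (by positivity), div_mul_eq_mul_div, div_le_one hn']; exact hτn
  have hθ' : |-(τ / n)| * B ≤ 1 := by rwa [abs_neg]
  have key : ∀ a : ℝ, ENNReal.ofReal |a / v - 1| ≤ ENNReal.ofReal τ⁻¹ *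
      (ENNReal.ofReal (Real.exp (τ / n * n * (a / v - 1))) +
       ENNReal.ofReal (Real.exp (-(τ / n) * n * (a / v - 1)))) := by
    intro a
    rw [← ENNReal.ofReal_add (Real.exp_pos _).le (Real.exp_pos _).le,
      ← ENNReal.ofReal_mul (by positivity)]
    refine ENNReal.ofReal_le_ofReal ?_
    rw [inv_mul_eq_div, le_div_iff₀ hτ0, neg_mul, div_mul_cancel₀ _ hn'.ne', neg_mul]
    set y := a / v - 1
    have h1 := Real.add_one_le_exp (τ * y)
    have h2 := Real.add_one_le_exp (-(τ * y))
    have h3 := Real.exp_pos (τ * y)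
    have h4 := Real.exp_pos (-(τ * y))
    rcases abs_cases y with ⟨h5, _⟩ | ⟨h5, _⟩ <;> rw [h5] <;> nlinarith
  refine (expect_mono _ key).trans ?_
  rw [expect_const_mul, expect_add]
  have e1 := h.expect_exp_empiricalMean_le hθ hn0 1
  have e2 := h.expect_exp_empiricalMean_le hθ' hn0 1
  have h5 : n * (τ / n + (τ / n) ^ 2 * B) - τ / n * n * 1 = 1 := by
    rw [div_pow, hτ2]; field_simp; ring
  have h6 : n * (-(τ / n) + (-(τ / n)) ^ 2 * B) - -(τ / n) * n * 1 = 1 := by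
    rw [neg_sq, div_pow, hτ2]; field_simp; ring
  rw [h5] at e1
  rw [h6] at e2
  refine (mul_le_mul_right (add_le_add e1 e2) _).trans ?_
  rw [← ENNReal.ofReal_add (Real.exp_pos _).le (Real.exp_pos _).le,
    ← ENNReal.ofReal_mul (by positivity), hinv, mul_comm]
  refine ENNReal.ofReal_le_ofReal (mul_le_mul_of_nonneg_right ?_ (by positivity))
  linarith [Real.exp_one_lt_d9]

/-- The empirical mean is unlikely to be off by a factor more than `4`. -/
theorem expect_empiricalMean_far_le (h : ScoreBound g μ v B) {n : ℕ} (hn : 0 < n) :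
    expect (empiricalMean g μ n).dist ({a | a < v / 4 ∨ 4 * v < a}.indicator 1) ≤
      ENNReal.ofReal (2 * Real.exp (-(n / (8 * B)))) := by
  have hv := h.v_pos
  have hB : 0 < B := one_pos.trans_le h.one_le
  have hn' : (0 : ℝ) < n := by exact_mod_cast hn
  -- Chernoff bounds: `θ = 1 / B` at level `4` gives exponent `-2 * n / B`, and `θ = -1 / (2 * B)`
  -- at level `1 / 4` gives `-n / (8 * B)`.
  have hθ₁ : |1 / B| * B ≤ 1 := by
    rw [abs_of_pos (by positivity)]; exact (by field_simp : 1 / B * B = 1).le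
  have hθ₂ : |-(1 / (2 * B))| * B ≤ 1 := by
    rw [abs_neg, abs_of_pos (by positivity)]
    rw [(by field_simp : 1 / (2 * B) * B = 1 / 2)]; norm_num
  have e1 := h.expect_exp_empiricalMean_le hθ₁ hn 4
  have e2 := h.expect_exp_empiricalMean_le hθ₂ hn (1 / 4)
  have key : ∀ a : ℝ, ({a | a < v / 4 ∨ 4 * v < a} : Set ℝ).indicator (1 : ℝ → ℝ≥0∞) a ≤
      ENNReal.ofReal (Real.exp (1 / B * n * (a / v - 4))) +
      ENNReal.ofReal (Real.exp (-(1 / (2 * B)) * n * (a / v - 1 / 4))) := by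
    intro a
    refine Set.indicator_le (g := fun a : ℝ => ENNReal.ofReal (Real.exp (1 / B * n * (a / v - 4))) +
      ENNReal.ofReal (Real.exp (-(1 / (2 * B)) * n * (a / v - 1 / 4)))) (fun a ha => ?_) a
    rw [Pi.one_apply, ← ENNReal.ofReal_one]
    rcases (ha : a < v / 4 ∨ 4 * v < a) with ha | ha
    · refine (ENNReal.ofReal_le_ofReal (Real.one_le_exp ?_)).trans le_add_self
      have : a / v ≤ 1 / 4 := by rw [div_le_iff₀ hv]; linarith
      have h0 : 0 ≤ 1 / (2 * B) * n := by positivity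
      nlinarith
    · refine (ENNReal.ofReal_le_ofReal (Real.one_le_exp ?_)).trans le_self_add
      have : 4 ≤ a / v := by rw [le_div_iff₀ hv]; linarith
      have h0 : 0 ≤ 1 / B * n := by positivity
      nlinarith
  refine (expect_mono _ key).trans ?_
  rw [expect_add]
  refine (add_le_add e1 e2).trans ?_
  rw [← ENNReal.ofReal_add (Real.exp_pos _).le (Real.exp_pos _).le,
    two_mul (Real.exp _)]
  refine ENNReal.ofReal_le_ofReal (add_le_add (Real.exp_le_exp.2 ?_) (Real.exp_le_exp.2 ?_))
  · have : n * (1 / B + (1 / B) ^ 2 * B) - 1 / B * n * 4 = -(n / (8 * B)) * 16 := by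
      field_simp; ring
    rw [this]
    have : 0 ≤ n / (8 * B) := by positivity
    linarith
  · apply le_of_eq
    field_simp; ring

end ScoreBound

/-! ### Rejection sampling -/

/-- The tilt of `μ` by `g`, which is proportional to `μ z * g z`. -/
noncomputable def tilt (g : Z → ℝ) (μ : PMF Z) : PMF Z :=
  open Classical in
  if h : (∑' z, μ z * ENNReal.ofReal (g z) ≠ 0) ∧ (∑' z, μ z * ENNReal.ofReal (g z) ≠ ∞) then
    PMF.normalize (fun z => μ z * ENNReal.ofReal (g z)) h.1 h.2
  else μ

namespace ScoreBound

variable {g : Z → ℝ} {μ : PMF Z} {v B : ℝ}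

theorem tilt_apply (h : ScoreBound g μ v B) (z : Z) :
    tilt g μ z = (ENNReal.ofReal v)⁻¹ * (μ z * ENNReal.ofReal (g z)) := by
  have h1 : ∑' z, μ z * ENNReal.ofReal (g z) = ENNReal.ofReal v := h.mean
  have h2 : (∑' z, μ z * ENNReal.ofReal (g z) ≠ 0) ∧
      (∑' z, μ z * ENNReal.ofReal (g z) ≠ ∞) := by
    rw [h1]
    exact ⟨(ENNReal.ofReal_pos.2 h.v_pos).ne', ENNReal.ofReal_ne_top⟩
  rw [tilt, dif_pos h2, PMF.normalize_apply, h1, mul_comm]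

theorem expect_tilt (h : ScoreBound g μ v B) (f : Z → ℝ≥0∞) :
    expect μ (fun z => ENNReal.ofReal (g z) * f z) = ENNReal.ofReal v * expect (tilt g μ) f := by
  simp only [expect, ← ENNReal.tsum_mul_left, h.tilt_apply]
  refine tsum_congr fun z => ?_
  rw [← mul_assoc, ← mul_assoc, ← mul_assoc (ENNReal.ofReal v),
    ENNReal.mul_inv_cancel (ENNReal.ofReal_pos.2 h.v_pos).ne' ENNReal.ofReal_ne_top, one_mul]

/-- As `g ≤ c`, acceptance probabilities are not clipped: a trial succeeds with probability `v / c`,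
and an accepted sample has exactly the tilted law. The only error is that all `n` trials fail. -/
theorem close_acceptReject (h : ScoreBound g μ v B) {c : ℝ} (hc : ∀ z, g z ≤ c) (n : ℕ) :
    Close ((1 - ENNReal.ofReal (v / c)) ^ n) (acceptReject g μ c n).dist (tilt g μ) := by
  have hc0 : 0 < c := by
    obtain ⟨z, _⟩ := μ.support_nonempty
    exact (h.pos z).trans_le (hc z)
  have hq : ∀ z, ENNReal.ofReal (g z / c) ≤ 1 := fun z =>
    ENNReal.ofReal_le_one.2 ((div_le_one hc0).2 (hc z))
  have hmul : ∀ x, ENNReal.ofReal (x / c) = ENNReal.ofReal c⁻¹ * ENNReal.ofReal x := fun x => by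
    rw [← ENNReal.ofReal_mul (by positivity), inv_mul_eq_div]
  have hmean : expect μ (fun z => ENNReal.ofReal (g z / c)) = ENNReal.ofReal (v / c) := by
    simp only [hmul, expect_const_mul, h.mean]
  have hp : ENNReal.ofReal (v / c) ≤ 1 := by rw [← hmean]; exact expect_le_of_le μ hq
  induction n with
  | zero => rw [pow_zero]; exact Close.of_one_le le_rfl _ _
  | succ n ih =>
    intro f hf
    have hstep : expect (acceptReject g μ c (n + 1)).dist f =
        expect μ fun z => ENNReal.ofReal (g z / c) * f z +
          (1 - ENNReal.ofReal (g z / c)) * expect (acceptReject g μ c n).dist f := by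
      simp only [acceptReject, Prog.dist_bind, Prog.dist_sample, Prog.dist_charge, PMF.pure_bind,
        Prog.dist_coin, expect_bind, expect_bernoulli]
      simp [Prog.dist_pure, expect_pure, min_eq_left (hq _)]
    have hrej : expect μ (fun z => 1 - ENNReal.ofReal (g z / c)) = 1 - ENNReal.ofReal (v / c) := by
      refine ENNReal.eq_sub_of_add_eq ENNReal.ofReal_ne_top ?_
      rw [← hmean, add_comm, expect_one_sub μ hq]
    have hacc : expect μ (fun z => ENNReal.ofReal (g z / c) * f z) =
        ENNReal.ofReal (v / c) * expect (tilt g μ) f := by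
      simp only [hmul, mul_assoc, expect_const_mul, h.expect_tilt]
    rw [hstep, expect_add, expect_mul_const, hrej, hacc]
    calc _ ≤ ENNReal.ofReal (v / c) * expect (tilt g μ) f + (1 - ENNReal.ofReal (v / c)) *
          (expect (tilt g μ) f + (1 - ENNReal.ofReal (v / c)) ^ n) := by gcongr; exact ih f hf
      _ = (ENNReal.ofReal (v / c) + (1 - ENNReal.ofReal (v / c))) * expect (tilt g μ) f +
          (1 - ENNReal.ofReal (v / c)) ^ (n + 1) := by ring
      _ = _ := by rw [add_tsub_cancel_of_le hp, one_mul]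

/-- The threshold `4 * B` leaves room for an empirical normaliser that is too small by a factor `4`.
If the normaliser is also at most `4 * v`, each trial succeeds with probability at least `1 / (16 *
B)`. A bad normaliser costs at most `δ / 2`, and failure of all trials `δ / 4`. -/
theorem close_rejectionSampling (h : ScoreBound g μ v B) {δ : ℝ} (hδ : 0 < δ) (hδ1 : δ < 1) :
    Close (ENNReal.ofReal δ) (rejectionSampling g μ (4 * B) δ).dist (tilt g μ) := by
  have hv := h.v_pos
  have hB : 0 < B := one_pos.trans_le h.one_le
  set N := ⌈4 * (4 * B) * Real.log (4 / δ)⌉₊ with hN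
  have hlog : 0 < Real.log (4 / δ) := Real.log_pos (by rw [lt_div_iff₀ hδ]; linarith)
  have hNle : 16 * B * Real.log (4 / δ) ≤ N := by
    refine le_trans (le_of_eq ?_) (Nat.le_ceil _); ring
  have hN' : (0 : ℝ) < N := lt_of_lt_of_le (by positivity) hNle
  have hN0 : 0 < N := by exact_mod_cast hN'
  have hexp : ∀ y, Real.log (4 / δ) ≤ y → Real.exp (-y) ≤ δ / 4 := fun y hy => by
    calc _ ≤ Real.exp (-Real.log (4 / δ)) := Real.exp_le_exp.2 (by linarith)
      _ = δ / 4 := by rw [Real.exp_neg, Real.exp_log (by positivity), inv_div]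
  have hpt : ∀ a : ℝ, Close (({a | a < v / 4 ∨ 4 * v < a} : Set ℝ).indicator 1 a +
      ENNReal.ofReal (δ / 4)) (acceptReject g μ (4 * B * a) N).dist (tilt g μ) := by
    intro a
    by_cases ha : a ∈ ({a | a < v / 4 ∨ 4 * v < a} : Set ℝ)
    · rw [Set.indicator_of_mem ha]; exact Close.of_one_le le_self_add _ _
    · rw [Set.indicator_of_notMem ha, zero_add]
      simp only [Set.mem_ofPred_eq, not_or, not_lt] at ha
      have ha0 : 0 < a := by linarith
      have hc : ∀ z, g z ≤ 4 * B * a := fun z => (h.le z).trans (by nlinarith)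
      refine (h.close_acceptReject hc N).mono ?_
      have hp : 1 / (16 * B) ≤ v / (4 * B * a) := by
        rw [div_le_div_iff₀ (by positivity) (by positivity)]; nlinarith
      have h1 : 1 - ENNReal.ofReal (v / (4 * B * a)) ≤ ENNReal.ofReal (Real.exp (-(1 / (16 * B)))) := by
        rw [← ENNReal.ofReal_one, ← ENNReal.ofReal_sub _ (by positivity)]
        refine ENNReal.ofReal_le_ofReal ?_
        linarith [Real.add_one_le_exp (-(1 / (16 * B)))]
      refine (pow_le_pow_left' h1 N).trans ?_
      rw [← ENNReal.ofReal_pow (Real.exp_pos _).le, ← Real.exp_nat_mul, mul_neg]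
      refine ENNReal.ofReal_le_ofReal (hexp _ ?_)
      rw [mul_one_div, le_div_iff₀ (by positivity)]
      linarith
  have hbind := Close.bind_right (empiricalMean g μ N).dist hpt
  rw [PMF.bind_const, expect_add, expect_const] at hbind
  simp only [rejectionSampling, Prog.dist_bind, Prog.dist_charge, PMF.pure_bind]
  refine hbind.mono ((add_le_add (h.expect_empiricalMean_far_le hN0) le_rfl).trans ?_)
  rw [← ENNReal.ofReal_add (by positivity) (by positivity)]
  refine ENNReal.ofReal_le_ofReal ?_
  have := hexp (N / (8 * B)) (by rw [le_div_iff₀ (by positivity)]; nlinarith)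
  linarith

end ScoreBound

end Scores

/-! ### Logarithmic errors and acceptance probabilities -/

/-- The truncated logarithmic distance of `x` to `1`. -/
noncomputable def logErr (x : ℝ) : ℝ := if x ≤ 0 then 1 else min 1 |Real.log x|

theorem logErr_nonneg (x : ℝ) : 0 ≤ logErr x := by
  unfold logErr; split_ifs <;> positivity

theorem logErr_inv (x : ℝ) : logErr x⁻¹ = logErr x := by
  simp [logErr, inv_nonpos, Real.log_inv]

/-- Truncation at `1` preserves the triangle inequality for `|log|`, and a nonpositive factor
already contributes the maximal value. Errors of products of estimates thus add up, while a tiny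
estimate costs no more than `1`. -/
theorem logErr_mul_le (x y : ℝ) : logErr (x * y) ≤ logErr x + logErr y := by
  have h1 : logErr (x * y) ≤ 1 := by
    unfold logErr; split_ifs
    · exact le_rfl
    · exact min_le_left _ _
  rcases le_or_gt x 0 with hx | hx
  · have : logErr x = 1 := if_pos hx
    linarith [logErr_nonneg y]
  rcases le_or_gt y 0 with hy | hy
  · have : logErr y = 1 := if_pos hy
    linarith [logErr_nonneg x]
  have h2 : logErr (x * y) ≤ |Real.log x| + |Real.log y| := by
    rw [logErr, if_neg (not_le.2 (mul_pos hx hy)), Real.log_mul hx.ne' hy.ne']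
    exact (min_le_right _ _).trans (abs_add_le _ _)
  have h3 : logErr x = min 1 |Real.log x| := if_neg (not_le.2 hx)
  have h4 : logErr y = min 1 |Real.log y| := if_neg (not_le.2 hy)
  rw [h3, h4]
  rcases min_cases 1 |Real.log x| with h | h <;> rcases min_cases 1 |Real.log y| with h' | h' <;>
    linarith [abs_nonneg (Real.log x), abs_nonneg (Real.log y)]

/-- Below `1 / 2` the truncation suffices; above it the slope of `log` is at most `2`. -/
theorem logErr_le_two_mul_abs (x : ℝ) : logErr x ≤ 2 * |x - 1| := by
  unfold logErr
  split_ifs with hx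
  · rw [abs_of_nonpos (by linarith)]; linarith
  rw [not_le] at hx
  rcases le_or_gt x (1 / 2) with h | h
  · rw [abs_of_nonpos (by linarith : x - 1 ≤ 0)]
    exact (min_le_left _ _).trans (by linarith)
  refine (min_le_right _ _).trans (abs_le.2 ⟨?_, ?_⟩)
  · have h1 := Real.one_sub_inv_le_log_of_pos hx
    rcases le_or_gt 1 x with h2 | h2
    · linarith [Real.log_nonneg h2, abs_nonneg (x - 1)]
    · rw [abs_of_neg (by linarith)]
      have h3 : x⁻¹ ≤ 1 + 2 * (1 - x) := by
        rw [inv_le_iff_one_le_mul₀ hx]; nlinarith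
      linarith
  · linarith [Real.log_le_sub_one_of_pos hx, le_abs_self (x - 1), abs_nonneg (x - 1)]

/-- For `b < a`, shrinking `min a 1` by the factor `b / a` loses at most `1 - b / a ≤ |log (a /
b)|`, because the clipped value is at most `1`. -/
theorem min_one_le_add_logErr {a b : ℝ} (ha : 0 < a) (hb : 0 < b) :
    min a 1 ≤ min b 1 + logErr (a / b) := by
  rw [logErr, if_neg (not_le.2 (div_pos ha hb))]
  rcases le_or_gt a b with h | h
  · have : 0 ≤ min 1 |Real.log (a / b)| := by positivity
    linarith [min_le_min_right 1 h]
  · have h0 : 0 ≤ b / a := by positivity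
    have h1 : 1 - b / a ≤ |Real.log (a / b)| := by
      have := Real.one_sub_inv_le_log_of_pos (div_pos ha hb)
      rw [inv_div] at this
      exact this.trans (le_abs_self _)
    have h2 : min a 1 * (b / a) ≤ min b 1 := by
      refine le_min ?_ ?_
      · calc min a 1 * (b / a) ≤ a * (b / a) := by gcongr; exact min_le_left _ _
          _ = b := by field_simp
      · calc min a 1 * (b / a) ≤ 1 * (b / a) := by gcongr; exact min_le_right _ _
          _ ≤ 1 := by rw [one_mul, div_le_one ha]; exact h.le
    have h3 : min a 1 * (1 - b / a) ≤ 1 - b / a :=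
      mul_le_of_le_one_left (sub_nonneg.2 ((div_le_one ha).2 h.le)) (min_le_right _ _)
    have h4 : 1 - b / a ≤ min 1 |Real.log (a / b)| := le_min (by linarith) h1
    linarith

/-- Here `a` stands for the estimated acceptance ratio. Its sign is left free: for `a ≤ 0` the error
is the maximal `1`. -/
theorem close_bernoulli (a : ℝ) {b : ℝ} (hb : 0 < b) :
    Close (ENNReal.ofReal (logErr (a / b))) (Prog.bernoulli a) (Prog.bernoulli b) := by
  have hmin : ∀ x, min (ENNReal.ofReal x) 1 = ENNReal.ofReal (min x 1) := fun x => by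
    rw [ENNReal.ofReal_min, ENNReal.ofReal_one]
  have hab : ENNReal.ofReal (min a 1) ≤
      ENNReal.ofReal (min b 1) + ENNReal.ofReal (logErr (a / b)) := by
    rw [← ENNReal.ofReal_add (by positivity) (logErr_nonneg _)]
    refine ENNReal.ofReal_le_ofReal ?_
    rcases le_or_gt a 0 with ha | ha
    · have : 0 < min b 1 := by positivity
      linarith [min_le_left a 1, logErr_nonneg (a / b)]
    · exact min_one_le_add_logErr ha hb
  have hba : ENNReal.ofReal (min b 1) ≤
      ENNReal.ofReal (min a 1) + ENNReal.ofReal (logErr (a / b)) := by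
    rcases le_or_gt a 0 with ha | ha
    · have : logErr (a / b) = 1 := if_pos (div_nonpos_of_nonpos_of_nonneg ha hb.le)
      rw [this]
      exact (ENNReal.ofReal_le_ofReal (min_le_right _ _)).trans le_add_self
    · rw [← ENNReal.ofReal_add (by positivity) (logErr_nonneg _), ← inv_div, logErr_inv]
      exact ENNReal.ofReal_le_ofReal (min_one_le_add_logErr hb ha)
  intro f hf
  rw [expect_bernoulli, expect_bernoulli, hmin, hmin]
  set p := ENNReal.ofReal (min a 1)
  set q := ENNReal.ofReal (min b 1)
  set c := ENNReal.ofReal (logErr (a / b))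
  rcases le_total p q with h | h
  · have h1 : 1 - p ≤ 1 - q + c := by
      rw [tsub_le_iff_right, add_assoc, add_comm c]
      exact le_tsub_add.trans (by gcongr)
    calc _ ≤ q * f true + (1 - q + c) * f false := by gcongr
      _ = q * f true + (1 - q) * f false + c * f false := by ring
      _ ≤ _ := by gcongr; exact (mul_le_mul_right (hf false) c).trans_eq (mul_one c)
  · calc _ ≤ (q + c) * f true + (1 - q) * f false := by gcongr
      _ = q * f true + (1 - q) * f false + c * f true := by ring
      _ ≤ _ := by gcongr; exact (mul_le_mul_right (hf true) c).trans_eq (mul_one c)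

/-! ### The Metropolis-Hastings kernel with an independent proposal -/

section Metropolis

variable {Ω : Type}

/-- One Metropolis-Hastings step from `a` with the independent proposal `Q`, for the target
proportional to `Q * r`. -/
noncomputable def mhKernel (Q : PMF Ω) (r : Ω → ℝ) (a : Ω) : PMF Ω :=
  Q.bind fun s => (Prog.bernoulli (r s / r a)).bind fun b =>
    if b then PMF.pure s else PMF.pure a

theorem expect_mhKernel (Q : PMF Ω) (r : Ω → ℝ) (a : Ω) (f : Ω → ℝ≥0∞) :
    expect (mhKernel Q r a) f = expect Q fun s =>
      min (ENNReal.ofReal (r s / r a)) 1 * f s +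
        (1 - min (ENNReal.ofReal (r s / r a)) 1) * f a := by
  simp [mhKernel, expect_bind, expect_bernoulli, expect_pure]

theorem PMF.ext_expect {μ ν : PMF Ω} (h : ∀ f : Ω → ℝ≥0∞, expect μ f = expect ν f) : μ = ν := by
  classical
  ext x
  have key : ∀ ρ : PMF Ω, expect ρ (Set.indicator {x} 1) = ρ x := fun ρ => by
    rw [expect_indicator, PMF.toOuterMeasure_apply_singleton]
  rw [← key μ, ← key ν, h]

/-- The target is stationary for the Metropolis-Hastings kernel. -/
theorem bind_mhKernel {Q π : PMF Ω} {r : Ω → ℝ} (hr : ∀ s, 0 < r s) {c : ℝ≥0∞}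
    (hπ : ∀ s, π s = c * (Q s * ENNReal.ofReal (r s))) : π.bind (mhKernel Q r) = π := by
  have hexp : ∀ F : Ω → ℝ≥0∞, expect π F = c * expect Q (fun a => ENNReal.ofReal (r a) * F a) := by
    intro F
    simp only [expect, hπ, ← ENNReal.tsum_mul_left]
    exact tsum_congr fun a => by ring
  have hmin : ∀ a s, ENNReal.ofReal (r a) * min (ENNReal.ofReal (r s / r a)) 1 =
      ENNReal.ofReal (min (r s) (r a)) := by
    intro a s
    rw [← ENNReal.ofReal_one, ← ENNReal.ofReal_min, ← ENNReal.ofReal_mul (hr a).le,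
      mul_min_of_nonneg _ _ (hr a).le, mul_div_cancel₀ _ (hr a).ne', mul_one]
  refine PMF.ext_expect fun f => ?_
  rw [expect_bind]
  simp only [expect_mhKernel, expect_add]
  -- Detailed balance: up to the constant `c`, both sides integrate against `Q × Q` the weight `min
  -- (r s) (r a)`, which is symmetric in `a` and `s`.
  have hswap : expect π (fun a => expect Q fun s => min (ENNReal.ofReal (r s / r a)) 1 * f s) =
      expect π (fun a => expect Q fun s => min (ENNReal.ofReal (r s / r a)) 1 * f a) := by
    rw [hexp, hexp]
    simp only [← expect_const_mul, ← mul_assoc, hmin]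
    rw [expect_comm]
    simp only [min_comm]
  rw [hswap, ← expect_add]
  refine congrArg _ (funext fun a => ?_)
  rw [← expect_add]
  simp only [← add_mul, add_tsub_cancel_of_le (min_le_right _ _), one_mul, expect_const]

/-- Keeping only accepted moves already gives mass `β * Q s`. This is the minorisation that
`Close.contract` asks for. -/
theorem le_mhKernel {Q : PMF Ω} {r : Ω → ℝ} {β : ℝ} (hβ : β ≤ 1) (hr : ∀ a s, β ≤ r s / r a)
    (a s : Ω) : ENNReal.ofReal β * Q s ≤ mhKernel Q r a s := by
  have key : ∀ ρ : PMF Ω, expect ρ (Set.indicator {s} 1) = ρ s := fun ρ => by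
    rw [expect_indicator, PMF.toOuterMeasure_apply_singleton]
  rw [← key Q, ← key, expect_mhKernel, ← expect_const_mul]
  refine expect_mono _ fun s' => le_trans ?_ le_self_add
  gcongr
  exact le_min (ENNReal.ofReal_le_ofReal (hr a s')) (ENNReal.ofReal_le_one.2 hβ)

end Metropolis

namespace ReasoningModel

/-! ### The exact proposal and its importance weights -/

variable {S : ℕ → Type} (m : ReasoningModel S) (s₀ : S 0)

/-- The proposal obtained by exact tilting in each step. -/
noncomputable def proposal : (t : ℕ) → PMF (Prefix S t)
  | 0 => PMF.pure ()
  | t + 1 => (proposal t).bind fun s =>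
      (tilt (fun y => m.V s₀ (t + 1) (s, y)) (m.ref s₀ t s)).map fun x => (s, x)

/-- The density `∏ V(s_{1:k}) / Z_k(s_{1:k-1})` of the proposal with respect to the base model. -/
noncomputable def proposalWeight : (t : ℕ) → Prefix S t → ℝ
  | 0, _ => 1
  | t + 1, (s, x) => proposalWeight t s * (m.V s₀ (t + 1) (s, x) / m.nextValue s₀ t s)

/-- The density of the target with respect to the proposal, up to a constant factor. -/
noncomputable def importance (t : ℕ) (s : Prefix S t) : ℝ :=
  m.V s₀ t s / m.proposalWeight s₀ t s

theorem _root_.PMF.bind_map_mk_apply {α β : Type} (μ : PMF α) (k : α → PMF β) (s : α) (x : β) :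
    (μ.bind fun s => (k s).map fun x => (s, x)) (s, x) = μ s * k s x := by
  classical
  rw [PMF.bind_apply, tsum_eq_single s]
  · congr 1
    rw [PMF.map_apply, tsum_eq_single x] <;> simp +contextual [eq_comm]
  · intro s' hs'
    simp [PMF.map_apply, hs'.symm]

theorem proposal_succ_apply (t : ℕ) (s : Prefix S t) (x : S (t + 1)) :
    m.proposal s₀ (t + 1) (s, x) =
      m.proposal s₀ t s * tilt (fun y => m.V s₀ (t + 1) (s, y)) (m.ref s₀ t s) x :=
  PMF.bind_map_mk_apply _ _ _ _

theorem refPath_succ_apply (t : ℕ) (s : Prefix S t) (x : S (t + 1)) :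
    m.refPath s₀ (t + 1) (s, x) = m.refPath s₀ t s * m.ref s₀ t s x :=
  PMF.bind_map_mk_apply _ _ _ _

variable {m s₀} {T : ℕ} {L ε : ℝ}

/-- The next score is at most `L` times the current one, which the Bellman bound places within `1 +
ε` of the normaliser. -/
theorem scoreBound (hL : m.RatioBound s₀ T L) (hε : m.BellmanBound s₀ T ε) (hL1 : 1 ≤ L)
    {t : ℕ} (ht : t < T) (s : Prefix S t) :
    ScoreBound (fun x => m.V s₀ (t + 1) (s, x)) (m.ref s₀ t s) (m.nextValue s₀ t s)
      (L * (1 + ε)) := by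
  have hV : ∀ x, m.V s₀ (t + 1) (s, x) ≤ L * m.V s₀ t s := fun x =>
    (div_le_iff₀ (m.V_pos _ _ _)).1 (hL t ht s x).2
  have hfin : expect (m.ref s₀ t s) (fun x => ENNReal.ofReal (m.V s₀ (t + 1) (s, x))) ≠ ∞ :=
    ne_top_of_le_ne_top ENNReal.ofReal_ne_top
      (expect_le_of_le _ fun x => ENNReal.ofReal_le_ofReal (hV x))
  have hpos : expect (m.ref s₀ t s) (fun x => ENNReal.ofReal (m.V s₀ (t + 1) (s, x))) ≠ 0 := by
    intro h
    obtain ⟨x, hx⟩ := (m.ref s₀ t s).support_nonempty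
    have h1 := ENNReal.tsum_eq_zero.1 h x
    rw [mul_eq_zero] at h1
    rcases h1 with h1 | h1
    · exact (PMF.mem_support_iff _ _).1 hx h1
    · exact absurd (ENNReal.ofReal_eq_zero.1 h1) (not_le.2 (m.V_pos _ _ _))
  have heq : m.nextValue s₀ t s =
      (expect (m.ref s₀ t s) fun x => ENNReal.ofReal (m.V s₀ (t + 1) (s, x))).toReal := by
    unfold expect at hfin ⊢
    rw [ENNReal.tsum_toReal_eq fun x => ENNReal.ne_top_of_tsum_ne_top hfin x, nextValue]
    refine tsum_congr fun x => ?_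
    rw [ENNReal.toReal_mul]
    exact congrArg _ (ENNReal.toReal_ofReal (m.V_pos _ _ _).le).symm
  have hZ : 0 < m.nextValue s₀ t s := by rw [heq]; exact ENNReal.toReal_pos hpos hfin
  refine ⟨hZ, fun x => m.V_pos _ _ _, fun x => (hV x).trans ?_, ?_⟩
  · rw [mul_assoc]
    exact mul_le_mul_of_nonneg_left ((div_le_iff₀ hZ).1 (hε t ht s).1) (by linarith)
  · rw [heq, ENNReal.ofReal_toReal hfin]

theorem proposalWeight_pos (hL : m.RatioBound s₀ T L) (hε : m.BellmanBound s₀ T ε)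
    (hL1 : 1 ≤ L) : ∀ t ≤ T, ∀ s : Prefix S t, 0 < m.proposalWeight s₀ t s
  | 0, _, _ => one_pos
  | t + 1, ht, (s, _) =>
    mul_pos (proposalWeight_pos hL hε hL1 t (Nat.le_of_succ_le ht) s)
      (div_pos (m.V_pos _ _ _) (scoreBound hL hε hL1 ht s).v_pos)

theorem proposal_apply (hL : m.RatioBound s₀ T L) (hε : m.BellmanBound s₀ T ε)
    (hL1 : 1 ≤ L) : ∀ t ≤ T, ∀ s : Prefix S t,
    m.proposal s₀ t s = m.refPath s₀ t s * ENNReal.ofReal (m.proposalWeight s₀ t s)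
  | 0, _, s => by simp [proposal, refPath, proposalWeight]
  | t + 1, ht, (s, x) => by
    have hZ := (scoreBound hL hε hL1 ht s).v_pos
    rw [proposal_succ_apply, refPath_succ_apply, proposalWeight,
      proposal_apply hL hε hL1 t (Nat.le_of_succ_le ht) s,
      (scoreBound hL hε hL1 ht s).tilt_apply,
      ENNReal.ofReal_mul (proposalWeight_pos hL hε hL1 t (Nat.le_of_succ_le ht) s).le,
      ENNReal.ofReal_div_of_pos hZ, ENNReal.div_eq_inv_mul]
    ring

/-- Appending a token cancels the new score and multiplies the importance by `nextValue / V` at the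
old prefix, which lies within a factor `1 + ε` of `1`. Hence `L` does not enter. -/
theorem importance_bounds (hL : m.RatioBound s₀ T L) (hε : m.BellmanBound s₀ T ε)
    (hL1 : 1 ≤ L) (hε0 : 0 < ε) : ∀ t ≤ T, ∀ s : Prefix S t,
    m.importance s₀ t s ≤ m.V s₀ 0 () * (1 + ε) ^ t ∧
      m.V s₀ 0 () ≤ m.importance s₀ t s * (1 + ε) ^ t
  | 0, _, s => by
    have : m.importance s₀ 0 s = m.V s₀ 0 () := div_one _
    simp [this]
  | t + 1, ht, (s, x) => by
    have hZ := (scoreBound hL hε hL1 ht s).v_pos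
    have hW := proposalWeight_pos hL hε hL1 t (Nat.le_of_succ_le ht) s
    have hV := m.V_pos s₀ t s
    have hV' := m.V_pos s₀ (t + 1) (s, x)
    have ih := importance_bounds hL hε hL1 hε0 t (Nat.le_of_succ_le ht) s
    have hb := hε t ht s
    have hr : m.importance s₀ (t + 1) (s, x) =
        m.importance s₀ t s * (m.nextValue s₀ t s / m.V s₀ t s) := by
      change m.V s₀ (t + 1) (s, x) / (m.proposalWeight s₀ t s *
        (m.V s₀ (t + 1) (s, x) / m.nextValue s₀ t s)) = m.V s₀ t s / m.proposalWeight s₀ t s * _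
      field_simp
    have hr' : m.importance s₀ t s =
        m.importance s₀ (t + 1) (s, x) * (m.V s₀ t s / m.nextValue s₀ t s) := by
      rw [hr]; field_simp
    have hpos : 0 < m.importance s₀ t s := div_pos hV hW
    have hpos' : 0 < m.importance s₀ (t + 1) (s, x) := by rw [hr]; positivity
    constructor
    · rw [hr, pow_succ, ← mul_assoc]
      exact mul_le_mul ih.1 hb.2 (by positivity) (hpos.le.trans ih.1)
    · refine ih.2.trans ?_
      rw [hr', pow_succ', ← mul_assoc]
      gcongr
      exact hb.1

end ReasoningModel

namespace ReasoningModel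

variable {S : ℕ → Type} (m : ReasoningModel S) (s₀ : S 0)

/-! ### The inner loop -/

/-- The inner loop with an accepted prefix, where exact tilting replaces rejection sampling. -/
noncomputable def exactInnerLoop (Nm : ℕ) :
    (t : ℕ) → Prefix S t → PMF (Prefix S t × ℝ × ℝ)
  | 0, _ => PMF.pure ((), 1, 1)
  | t + 1, (a, y) => (exactInnerLoop Nm t a).bind fun p =>
      (tilt (fun y => m.V s₀ (t + 1) (p.1, y)) (m.ref s₀ t p.1)).bind fun x =>
      (m.estNormalizer s₀ Nm t p.1).dist.bind fun z =>
      (m.estNormalizer s₀ Nm t a).dist.bind fun z' =>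
      PMF.pure ((p.1, x), p.2.1 * (m.V s₀ (t + 1) (p.1, x) / z),
        p.2.2 * (m.V s₀ (t + 1) (a, y) / z'))

theorem dist_innerLoop_succ (Nm : ℕ) (M δ : ℝ) (t : ℕ) (a : Prefix S t) (y : S (t + 1)) :
    (m.innerLoop s₀ Nm M δ (t + 1) (some (a, y))).dist =
      (m.innerLoop s₀ Nm M δ t (some a)).dist.bind fun p =>
      (rejectionSampling (fun y => m.V s₀ (t + 1) (p.1, y)) (m.ref s₀ t p.1) M δ).dist.bind fun x =>
      (m.estNormalizer s₀ Nm t p.1).dist.bind fun z =>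
      (m.estNormalizer s₀ Nm t a).dist.bind fun z' =>
      PMF.pure ((p.1, x), p.2.1 * (m.V s₀ (t + 1) (p.1, x) / z),
        p.2.2 * (m.V s₀ (t + 1) (a, y) / z')) := by
  simp only [innerLoop, Prog.dist_bind, Prog.dist_charge, PMF.pure_bind, Prog.dist_pure]
  rfl

variable {m s₀} {T : ℕ} {L ε : ℝ}

/-- Both loops use the same estimation kernels, so each token costs only the error of one rejection
sampler. -/
theorem close_innerLoop (hL : m.RatioBound s₀ T L) (hε : m.BellmanBound s₀ T ε)
    (hL1 : 1 ≤ L) (Nm : ℕ) {δ : ℝ} (hδ : 0 < δ) (hδ1 : δ < 1) :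
    ∀ t ≤ T, ∀ a : Prefix S t, Close (ENNReal.ofReal (t * δ))
      (m.innerLoop s₀ Nm (4 * (L * (1 + ε))) δ t (some a)).dist (m.exactInnerLoop s₀ Nm t a)
  | 0, _, a => by
    have : (m.innerLoop s₀ Nm (4 * (L * (1 + ε))) δ 0 (some a)).dist =
        m.exactInnerLoop s₀ Nm 0 a := Prog.dist_pure _
    rw [this]
    exact (Close.refl _).mono zero_le
  | t + 1, ht, (a, y) => by
    rw [dist_innerLoop_succ, exactInnerLoop]
    refine Close.mono ((close_innerLoop hL hε hL1 Nm hδ hδ1 t (Nat.le_of_succ_le ht) a).bind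
      fun p => ((scoreBound hL hε hL1 ht p.1).close_rejectionSampling hδ hδ1).bind_left _) ?_
    rw [← ENNReal.ofReal_add (by positivity) hδ.le]
    refine ENNReal.ofReal_le_ofReal (le_of_eq ?_)
    push_cast; ring

/-- The estimates never influence which tokens are drawn, so the proposal does not depend on the
accepted trajectory `a`. -/
theorem map_fst_exactInnerLoop (Nm : ℕ) : ∀ (t : ℕ) (a : Prefix S t),
    (m.exactInnerLoop s₀ Nm t a).map Prod.fst = m.proposal s₀ t
  | 0, a => PMF.pure_map _ _
  | t + 1, (a, y) => by
    rw [exactInnerLoop, proposal, ← map_fst_exactInnerLoop Nm t a, PMF.map_bind, PMF.bind_map]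
    congr 1
    funext p
    simp only [PMF.map_bind, PMF.pure_map, PMF.bind_const]
    exact PMF.bind_pure_comp _ _

theorem expect_logErr_estNormalizer_le (hL : m.RatioBound s₀ T L) (hε : m.BellmanBound s₀ T ε)
    (hL1 : 1 ≤ L) {Nm : ℕ} (hNm : L * (1 + ε) ≤ Nm) {t : ℕ} (ht : t < T) (s : Prefix S t) :
    expect (m.estNormalizer s₀ Nm t s).dist
      (fun z => ENNReal.ofReal (logErr (z / m.nextValue s₀ t s))) ≤
      ENNReal.ofReal (12 * √(L * (1 + ε) / Nm)) := by
  calc _ ≤ expect (m.estNormalizer s₀ Nm t s).dist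
        (fun z => ENNReal.ofReal 2 * ENNReal.ofReal |z / m.nextValue s₀ t s - 1|) := by
        refine expect_mono _ fun z => ?_
        rw [← ENNReal.ofReal_mul two_pos.le]
        exact ENNReal.ofReal_le_ofReal (logErr_le_two_mul_abs _)
    _ ≤ ENNReal.ofReal 2 * ENNReal.ofReal (6 * √(L * (1 + ε) / Nm)) := by
        rw [expect_const_mul]
        gcongr
        exact (scoreBound hL hε hL1 ht s).expect_abs_empiricalMean_le hNm
    _ = _ := by rw [← ENNReal.ofReal_mul two_pos.le]; congr 1; ring

/-- The score `v` is evaluated exactly and cancels; only the normaliser estimate contributes a new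
error. -/
theorem logErr_weight_le {w z v W Z : ℝ} (hv : 0 < v) :
    ENNReal.ofReal (logErr (w * (v / z) / (W * (v / Z)))) ≤
      ENNReal.ofReal (logErr (w / W)) + ENNReal.ofReal (logErr (z / Z)) := by
  rw [← ENNReal.ofReal_add (logErr_nonneg _) (logErr_nonneg _)]
  refine ENNReal.ofReal_le_ofReal ?_
  have : w * (v / z) / (W * (v / Z)) = w / W * (z / Z)⁻¹ := by
    rw [mul_div_mul_comm, div_div_div_cancel_left' _ _ hv.ne', inv_div]
  rw [this, ← logErr_inv (z / Z)]
  exact logErr_mul_le _ _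

/-- The expected logarithmic error of the two cumulative weights. -/
theorem expect_logErr_exactInnerLoop_le (hL : m.RatioBound s₀ T L)
    (hε : m.BellmanBound s₀ T ε) (hL1 : 1 ≤ L) {Nm : ℕ} (hNm : L * (1 + ε) ≤ Nm) :
    ∀ t ≤ T, ∀ a : Prefix S t, expect (m.exactInnerLoop s₀ Nm t a) (fun p =>
      ENNReal.ofReal (logErr (p.2.2 / m.proposalWeight s₀ t a)) +
      ENNReal.ofReal (logErr (p.2.1 / m.proposalWeight s₀ t p.1))) ≤
      ENNReal.ofReal (t * (24 * √(L * (1 + ε) / Nm)))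
  | 0, _, a => by
    simp [exactInnerLoop, expect_pure, proposalWeight, logErr, not_le.2 (one_pos (α := ℝ))]
  | t + 1, ht, (a, y) => by
    have ih := expect_logErr_exactInnerLoop_le hL hε hL1 hNm t (Nat.le_of_succ_le ht) a
    have hest := fun s => expect_logErr_estNormalizer_le hL hε hL1 hNm ht (s := s)
    set b := 12 * √(L * (1 + ε) / Nm) with hb
    have hb0 : 0 ≤ b := by positivity
    simp only [exactInnerLoop, expect_bind, expect_pure]
    calc _ ≤ expect (m.exactInnerLoop s₀ Nm t a) (fun p =>
          (ENNReal.ofReal (logErr (p.2.2 / m.proposalWeight s₀ t a)) +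
          ENNReal.ofReal (logErr (p.2.1 / m.proposalWeight s₀ t p.1))) +
          (ENNReal.ofReal b + ENNReal.ofReal b)) := by
          -- Given the past and the new token, the two fresh estimates add at most `b` each in mean.
          refine expect_mono _ fun p => expect_le_of_le _ fun x => ?_
          calc _ ≤ expect (m.estNormalizer s₀ Nm t p.1).dist fun z =>
                expect (m.estNormalizer s₀ Nm t a).dist fun z' =>
                ((ENNReal.ofReal (logErr (p.2.2 / m.proposalWeight s₀ t a)) +
                ENNReal.ofReal (logErr (p.2.1 / m.proposalWeight s₀ t p.1))) +
                ENNReal.ofReal (logErr (z / m.nextValue s₀ t p.1))) +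
                ENNReal.ofReal (logErr (z' / m.nextValue s₀ t a)) := by
                refine expect_mono _ fun z => expect_mono _ fun z' => ?_
                refine (add_le_add (logErr_weight_le (m.V_pos _ _ _))
                  (logErr_weight_le (m.V_pos _ _ _))).trans_eq ?_
                ring
            _ ≤ _ := by
                simp only [expect_add, expect_const]
                rw [add_assoc]
                gcongr
                · exact hest p.1
                · exact hest a
      _ ≤ _ := by
          rw [expect_add, expect_const]
          refine (add_le_add ih le_rfl).trans ?_
          rw [← ENNReal.ofReal_add hb0 hb0, ← ENNReal.ofReal_add (by positivity) (by positivity)]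
          refine ENNReal.ofReal_le_ofReal (le_of_eq ?_)
          rw [hb]; push_cast; ring

/-! ### The outer loop -/

variable (m s₀) in
/-- The law of the accepted trajectory after one more iteration of the outer loop. -/
noncomputable def outerKernel (Nm : ℕ) (M δ : ℝ) (T : ℕ) (a : Prefix S T) : PMF (Prefix S T) :=
  (m.innerLoop s₀ Nm M δ T (some a)).dist.bind fun p =>
    (Prog.bernoulli (p.2.2 / m.V s₀ T a * (m.V s₀ T p.1 / p.2.1))).bind fun b =>
      if b then PMF.pure p.1 else PMF.pure a

variable (m s₀) in
theorem dist_outerLoop_succ (Nm : ℕ) (M δ : ℝ) (T k : ℕ) :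
    (m.outerLoop s₀ Nm M δ T (k + 1)).dist =
      (m.outerLoop s₀ Nm M δ T k).dist.bind (m.outerKernel s₀ Nm M δ T) := by
  simp only [outerLoop, Prog.dist_bind, Prog.dist_charge, PMF.pure_bind, Prog.dist_coin]
  congr 1
  funext a
  rw [outerKernel]
  congr 1
  funext p
  congr 1
  funext b
  cases b <;> exact Prog.dist_pure _

theorem importance_pos (hL : m.RatioBound s₀ T L) (hε : m.BellmanBound s₀ T ε)
    (hL1 : 1 ≤ L) (s : Prefix S T) : 0 < m.importance s₀ T s :=
  div_pos (m.V_pos _ _ _) (proposalWeight_pos hL hε hL1 T le_rfl s)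

theorem close_outerKernel (hL : m.RatioBound s₀ T L) (hε : m.BellmanBound s₀ T ε)
    (hL1 : 1 ≤ L) {Nm : ℕ} (hNm : L * (1 + ε) ≤ Nm) {δ : ℝ} (hδ : 0 < δ) (hδ1 : δ < 1)
    (a : Prefix S T) :
    Close (ENNReal.ofReal (T * δ + T * (24 * √(L * (1 + ε) / Nm))))
      (m.outerKernel s₀ Nm (4 * (L * (1 + ε))) δ T a)
      (mhKernel (m.proposal s₀ T) (m.importance s₀ T) a) := by
  -- Running the exact kernel on the space of the exact inner loop, whose estimates it ignores,
  -- gives both acceptance tests the same randomness.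
  have hexact : mhKernel (m.proposal s₀ T) (m.importance s₀ T) a =
      (m.exactInnerLoop s₀ Nm T a).bind fun p =>
        (Prog.bernoulli (m.importance s₀ T p.1 / m.importance s₀ T a)).bind fun b =>
        if b then PMF.pure p.1 else PMF.pure a := by
    rw [mhKernel, ← map_fst_exactInnerLoop Nm T a, PMF.bind_map]
    rfl
  rw [hexact, outerKernel, ENNReal.ofReal_add (by positivity) (by positivity)]
  refine ((close_innerLoop hL hε hL1 Nm hδ hδ1 T le_rfl a).bind_left _).trans ?_
  refine Close.mono (Close.bind_right _ fun p => ((close_bernoulli _ (div_pos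
    (importance_pos hL hε hL1 p.1) (importance_pos hL hε hL1 a))).mono ?_).bind_left _)
    (expect_logErr_exactInnerLoop_le hL hε hL1 hNm T le_rfl a)
  -- The estimated ratio over the exact one is the relative error of `w'` times the inverse relative
  -- error of `w`; the scores cancel.
  rw [← ENNReal.ofReal_add (logErr_nonneg _) (logErr_nonneg _), ← logErr_inv (p.2.1 / _)]
  refine ENNReal.ofReal_le_ofReal (le_trans (le_of_eq ?_) (logErr_mul_le _ _))
  have h1 := m.V_pos s₀ T a
  have h2 := m.V_pos s₀ T p.1
  have h3 := proposalWeight_pos hL hε hL1 T le_rfl a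
  have h4 := proposalWeight_pos hL hε hL1 T le_rfl p.1
  congr 1
  simp only [importance]
  field_simp

/-- The factorisation `refPath * V = (refPath * proposalWeight) * (V / proposalWeight)` exhibits the
target as proportional to proposal times importance. -/
theorem bind_mhKernel_target (hL : m.RatioBound s₀ T L) (hε : m.BellmanBound s₀ T ε)
    (hL1 : 1 ≤ L) : (m.target s₀ T hL).bind
      (mhKernel (m.proposal s₀ T) (m.importance s₀ T)) = m.target s₀ T hL := by
  refine bind_mhKernel (importance_pos hL hε hL1) (c := (∑' s, m.weight s₀ T s)⁻¹) fun s => ?_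
  have hW := proposalWeight_pos hL hε hL1 T le_rfl s
  rw [target, PMF.normalize_apply, weight, proposal_apply hL hε hL1 T le_rfl,
    mul_assoc (m.refPath s₀ T s) (ENNReal.ofReal (m.proposalWeight s₀ T s)),
    ← ENNReal.ofReal_mul hW.le, importance, mul_div_cancel₀ _ hW.ne', mul_comm]

theorem exp_le_importance_div (hL : m.RatioBound s₀ T L) (hε : m.BellmanBound s₀ T ε)
    (hL1 : 1 ≤ L) (hε0 : 0 < ε) {κ : ℝ} (hκ : T * ε ≤ κ) (a s : Prefix S T) :
    Real.exp (-(2 * κ)) ≤ m.importance s₀ T s / m.importance s₀ T a := by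
  have hs := (importance_bounds hL hε hL1 hε0 T le_rfl s).2
  have ha := (importance_bounds hL hε hL1 hε0 T le_rfl a).1
  have ha0 := importance_pos hL hε hL1 a
  have hs0 := importance_pos hL hε hL1 s
  have hpow : (1 + ε) ^ T ≤ Real.exp κ := by
    calc (1 + ε) ^ T ≤ Real.exp ε ^ T := by
          gcongr; linarith [Real.add_one_le_exp ε]
      _ = Real.exp (T * ε) := (Real.exp_nat_mul _ _).symm
      _ ≤ _ := Real.exp_le_exp.2 hκ
  rw [le_div_iff₀ ha0, Real.exp_neg, inv_mul_le_iff₀ (Real.exp_pos _), two_mul, Real.exp_add]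
  calc m.importance s₀ T a ≤ m.V s₀ 0 () * (1 + ε) ^ T := ha
    _ ≤ m.importance s₀ T s * (1 + ε) ^ T * (1 + ε) ^ T := by gcongr
    _ ≤ m.importance s₀ T s * Real.exp κ * Real.exp κ := by gcongr
    _ = _ := by ring

/-- The distance of the output to the target after `k + 1` iterations. -/
theorem close_outerLoop (hL : m.RatioBound s₀ T L) (hε : m.BellmanBound s₀ T ε)
    (hL1 : 1 ≤ L) (hε0 : 0 < ε) {κ : ℝ} (hκ0 : 0 < κ) (hκ : T * ε ≤ κ) {Nm : ℕ}
    (hNm : L * (1 + ε) ≤ Nm) {δ : ℝ} (hδ : 0 < δ) (hδ1 : δ < 1) (k : ℕ) :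
    Close (ENNReal.ofReal ((T * δ + T * (24 * √(L * (1 + ε) / Nm))) / Real.exp (-(2 * κ)) +
      (1 - Real.exp (-(2 * κ))) ^ k))
      (m.outerLoop s₀ Nm (4 * (L * (1 + ε))) δ T k).dist (m.target s₀ T hL) := by
  set β := Real.exp (-(2 * κ)) with hβ
  set η := T * δ + T * (24 * √(L * (1 + ε) / Nm)) with hη
  have hβ0 : 0 < β := Real.exp_pos _
  have hβ1 : β ≤ 1 := Real.exp_le_one_iff.2 (by linarith)
  have hη0 : 0 ≤ η := by positivity
  have hβ1' : 0 ≤ 1 - β := sub_nonneg.2 hβ1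
  induction k with
  | zero =>
    -- The bound is at least `1` here, so nothing about the first proposal is needed.
    refine Close.of_one_le ?_ _ _
    rw [pow_zero, ← ENNReal.ofReal_one]
    exact ENNReal.ofReal_le_ofReal (le_add_of_nonneg_left (by positivity))
  | succ k ih =>
    -- Replacing the real kernel by the exact one costs `η`, and contraction multiplies the old
    -- error by `1 - β`; `η / β` is the fixed point of this recursion.
    rw [dist_outerLoop_succ, ← bind_mhKernel_target hL hε hL1]
    refine Close.mono (((Close.bind_right _ fun a =>
      close_outerKernel hL hε hL1 hNm hδ hδ1 a).mono (expect_const _ _).le).trans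
      (ih.contract (le_mhKernel hβ1 fun a s => exp_le_importance_div hL hε hL1 hε0 hκ a s))) ?_
    rw [← ENNReal.ofReal_one, ← ENNReal.ofReal_sub _ hβ0.le, ← ENNReal.ofReal_mul hβ1',
      ← ENNReal.ofReal_add hη0 (by positivity)]
    refine ENNReal.ofReal_le_ofReal (le_of_eq ?_)
    field_simp
    ring

end ReasoningModel

/-! ### The choice of the parameters -/

section Parameters

variable {κ L B δ δTV β : ℝ} {T : ℕ}

theorem sqrt_div_ceil_le (hT : 1 ≤ T) (hB : 0 < B) (hβ : 0 < β) (hTV : 0 < δTV) :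
    √(B / ⌈B * (96 * T / (β * δTV)) ^ 2⌉₊) ≤ β * δTV / (96 * T) := by
  have hT' : (0 : ℝ) < T := by exact_mod_cast hT
  have h1 := Nat.le_ceil (B * (96 * T / (β * δTV)) ^ 2)
  have h0 : 0 < B * (96 * T / (β * δTV)) ^ 2 := by positivity
  refine Real.sqrt_le_iff.2 ⟨by positivity, ?_⟩
  rw [div_le_iff₀ (h0.trans_le h1)]
  calc B = (β * δTV / (96 * T)) ^ 2 * (B * (96 * T / (β * δTV)) ^ 2) := by field_simp
    _ ≤ _ := by gcongr

theorem one_sub_pow_ceil_le (hβ : 0 < β) (hβ1 : β ≤ 1) (hTV : 0 < δTV) :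
    (1 - β) ^ ⌈Real.log (2 / δTV) / β⌉₊ ≤ δTV / 2 := by
  have h1 := Nat.le_ceil (Real.log (2 / δTV) / β)
  rw [div_le_iff₀ hβ] at h1
  calc (1 - β) ^ ⌈Real.log (2 / δTV) / β⌉₊ ≤ Real.exp (-β) ^ ⌈Real.log (2 / δTV) / β⌉₊ := by
        exact pow_le_pow_left₀ (by linarith) (by linarith [Real.add_one_le_exp (-β)]) _
    _ = Real.exp (⌈Real.log (2 / δTV) / β⌉₊ * -β) := (Real.exp_nat_mul _ _).symm
    _ ≤ Real.exp (-Real.log (2 / δTV)) := Real.exp_le_exp.2 (by linarith)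
    _ = δTV / 2 := by rw [Real.exp_neg, Real.exp_log (by positivity), inv_div]

/-- This lower bound lets additive constants be absorbed into the factor `log (1 / δ)`. -/
theorem half_le_log_inv (hδ : 0 < δ) (hδ2 : δ ≤ 1 / 2) : 1 / 2 ≤ Real.log (1 / δ) := by
  have h1 : Real.log 2 ≤ Real.log (1 / δ) :=
    Real.log_le_log two_pos (by rw [le_div_iff₀ hδ]; linarith)
  linarith [Real.log_two_gt_d9]

theorem trials_le (hκ : 0 < κ) (hT : 1 ≤ T) (hL : 1 ≤ L) (hB0 : 0 < B) (hB : B ≤ L * (1 + κ))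
    (hδ : 0 < δ) (hδ2 : δ ≤ 1 / 2) (hTV : 0 < δTV) (hTV1 : δTV ≤ 1) :
    (⌈4 * (4 * B) *
      Real.log (4 / (Real.exp (-(2 * κ)) * δ ^ 2 * δTV / (4 * T)))⌉₊ : ℝ) ≤
      (16 * (1 + κ) * (10 + 4 * κ) + 2) *
        (L * Real.log (1 / δ) * (1 + Real.log (T / δTV))) := by
  have hT' : (1 : ℝ) ≤ T := by exact_mod_cast hT
  have hX : 1 ≤ T / δTV := by rw [le_div_iff₀ hTV]; linarith
  have hΛ := half_le_log_inv hδ hδ2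
  have hlog : Real.log (4 / (Real.exp (-(2 * κ)) * δ ^ 2 * δTV / (4 * T))) =
      Real.log 16 + 2 * κ + 2 * Real.log (1 / δ) + Real.log (T / δTV) := by
    have : 4 / (Real.exp (-(2 * κ)) * δ ^ 2 * δTV / (4 * T)) =
        16 * Real.exp (2 * κ) * (1 / δ) ^ 2 * (T / δTV) := by
      rw [Real.exp_neg]; field_simp; ring
    rw [this, Real.log_mul (by positivity) (by positivity),
      Real.log_mul (by positivity) (by positivity), Real.log_mul (by positivity) (by positivity),
      Real.log_exp, Real.log_pow]
    push_cast; ring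
  have h16 : Real.log 16 ≤ 3 := by
    rw [show (16 : ℝ) = 2 ^ 4 by norm_num, Real.log_pow]
    push_cast; linarith [Real.log_two_lt_d9]
  have hℓ : 1 ≤ 1 + Real.log (T / δTV) := by linarith [Real.log_nonneg hX]
  have h160 : 0 ≤ Real.log 16 := Real.log_nonneg (by norm_num)
  rw [hlog]
  generalize Real.log (1 / δ) = Λ at *
  generalize Real.log (T / δTV) = x at *
  obtain ⟨ℓ, rfl⟩ : ∃ ℓ, x = ℓ - 1 := ⟨x + 1, (add_sub_cancel_right x 1).symm⟩
  rw [add_sub_cancel] at *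
  have hp : 1 / 2 ≤ Λ * ℓ := by nlinarith
  -- Each summand is at most a multiple of `Λ * ℓ`, since `Λ ≥ 1 / 2` and `ℓ ≥ 1`.
  have hbr : Real.log 16 + 2 * κ + 2 * Λ + (ℓ - 1) ≤ (10 + 4 * κ) * (Λ * ℓ) := by
    nlinarith [mul_le_mul_of_nonneg_left hp hκ.le]
  have hΛℓ : 0 ≤ Λ * ℓ := by linarith
  have hnn : 0 ≤ 4 * (4 * B) * (Real.log 16 + 2 * κ + 2 * Λ + (ℓ - 1)) := by
    have : 0 ≤ Real.log 16 + 2 * κ + 2 * Λ + (ℓ - 1) := by linarith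
    positivity
  refine (Nat.ceil_lt_add_one hnn).le.trans ?_
  have h1 : 4 * (4 * B) * (Real.log 16 + 2 * κ + 2 * Λ + (ℓ - 1)) ≤
      4 * (4 * (L * (1 + κ))) * ((10 + 4 * κ) * (Λ * ℓ)) := by gcongr
  have h2 : 1 ≤ 2 * (L * Λ * ℓ) := by nlinarith
  calc _ ≤ 4 * (4 * (L * (1 + κ))) * ((10 + 4 * κ) * (Λ * ℓ)) + 2 * (L * Λ * ℓ) :=
        add_le_add h1 h2
    _ = _ := by ring

theorem samples_le (hT : 1 ≤ T) (hL : 1 ≤ L) (hB0 : 0 < B) (hB : B ≤ L * (1 + κ))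
    (hβ : 0 < β) (hTV : 0 < δTV) (hTV1 : δTV ≤ 1) :
    (⌈B * (96 * T / (β * δTV)) ^ 2⌉₊ : ℝ) ≤
      (9216 * (1 + κ) / β ^ 2 + 1) * (L * (T / δTV) ^ 2) := by
  have hT' : (1 : ℝ) ≤ T := by exact_mod_cast hT
  have hX : 1 ≤ T / δTV := by rw [le_div_iff₀ hTV]; linarith
  refine (Nat.ceil_lt_add_one (by positivity)).le.trans ?_
  have h2 : 1 ≤ L * (T / δTV) ^ 2 := one_le_mul_of_one_le_of_one_le hL (one_le_pow₀ hX)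
  calc _ ≤ L * (1 + κ) * (96 * T / (β * δTV)) ^ 2 + L * (T / δTV) ^ 2 := by gcongr
    _ = _ := by field_simp; ring

theorem iterations_le (hT : 1 ≤ T) (hβ : 0 < β) (hTV : 0 < δTV) (hTV1 : δTV ≤ 1) :
    (⌈Real.log (2 / δTV) / β⌉₊ : ℝ) + 1 ≤ (1 / β + 2) * (1 + Real.log (T / δTV)) := by
  have hT' : (1 : ℝ) ≤ T := by exact_mod_cast hT
  have hX : 1 ≤ T / δTV := by rw [le_div_iff₀ hTV]; linarith
  have hℓ := Real.log_nonneg hX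
  have h0 : 0 ≤ Real.log (2 / δTV) := Real.log_nonneg (by rw [le_div_iff₀ hTV]; linarith)
  have h1 : Real.log (2 / δTV) ≤ 1 + Real.log (T / δTV) := by
    calc Real.log (2 / δTV) ≤ Real.log (2 * (T / δTV)) := by
          refine Real.log_le_log (by positivity) ?_
          rw [← mul_div_assoc]; gcongr; linarith
      _ = Real.log 2 + Real.log (T / δTV) := Real.log_mul two_ne_zero (by positivity)
      _ ≤ _ := by linarith [Real.log_two_lt_d9]
  have h2 : Real.log (2 / δTV) / β ≤ (1 + Real.log (T / δTV)) / β := by gcongr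
  have h3 := Nat.ceil_lt_add_one (a := Real.log (2 / δTV) / β) (by positivity)
  calc _ ≤ (1 + Real.log (T / δTV)) / β + 2 * (1 + Real.log (T / δTV)) := by linarith
    _ = _ := by ring

/-- The total running time, from bounds on the number of iterations, of trials and of samples. -/
theorem total_time_le {k N Nm : ℕ} {a₁ a₂ a₃ Λ ℓ : ℝ} (hT : 1 ≤ T) (hL : 1 ≤ L) (hTV : 0 < δTV)
    (hTV1 : δTV ≤ 1) (hΛ : 1 / 2 ≤ Λ) (hℓ : 1 ≤ ℓ) (ha₁ : 0 ≤ a₁) (ha₂ : 0 ≤ a₂)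
    (hN : (N : ℝ) ≤ a₁ * (L * Λ * ℓ)) (hNm : (Nm : ℝ) ≤ a₂ * (L * (T / δTV) ^ 2))
    (hk : (k : ℝ) + 1 ≤ a₃ * ℓ) :
    (((k + 1) * (T * (7 * N + 6 * Nm + 12) + 6) : ℕ) : ℝ) ≤
      a₃ * (7 * a₁ + 12 * a₂ + 36) * (L * (T : ℝ) ^ 3 * Λ / δTV ^ 2) * ℓ ^ 2 := by
  have hT' : (1 : ℝ) ≤ T := by exact_mod_cast hT
  have hX : 1 ≤ T / δTV := by rw [le_div_iff₀ hTV]; linarith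
  have hX2 : 1 ≤ (T / δTV) ^ 2 := one_le_pow₀ hX
  set Y := L * (T / δTV) ^ 2 with hY
  have hLY : L ≤ Y := le_mul_of_one_le_right (by linarith) hX2
  have hY1 : 1 ≤ Y := hL.trans hLY
  have hΛℓ : 1 / 2 ≤ Λ * ℓ := by nlinarith
  have hW : 1 ≤ 2 * (Y * (Λ * ℓ)) := by nlinarith
  have h1 : (N : ℝ) ≤ a₁ * (Y * (Λ * ℓ)) := by
    refine hN.trans ?_
    rw [mul_assoc L]; gcongr
  have h2 : (Nm : ℝ) ≤ 2 * a₂ * (Y * (Λ * ℓ)) := by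
    refine hNm.trans ?_
    have : Y ≤ 2 * (Y * (Λ * ℓ)) := by nlinarith
    nlinarith [mul_le_mul_of_nonneg_left this ha₂]
  have h3 : (T : ℝ) * (7 * N + 6 * Nm + 12) + 6 ≤
      T * ((7 * a₁ + 12 * a₂ + 36) * (Y * (Λ * ℓ))) := by
    calc (T : ℝ) * (7 * N + 6 * Nm + 12) + 6 ≤ T * (7 * N + 6 * Nm + 12) + T * 6 := by linarith
      _ = T * (7 * N + 6 * Nm + 18) := by ring
      _ ≤ _ := by gcongr; linarith
  push_cast
  calc _ ≤ (a₃ * ℓ) * (T * ((7 * a₁ + 12 * a₂ + 36) * (Y * (Λ * ℓ)))) :=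
        mul_le_mul hk h3 (by positivity) ((by positivity : (0 : ℝ) ≤ k + 1).trans hk)
    _ = _ := by rw [hY]; field_simp

end Parameters

/-- The number of samples allows mean absolute errors of order `δTV / T` for the estimates of the
normalisers, so the total variation bound already holds for the unconditional law of the output,
without any restriction that relates `δ` to `δTV`: the event is the whole space of executions. -/
theorem mainTheorem10 (κ c₀ : ℝ) (hκ : 0 < κ) (hc₀ : 0 < c₀) :
    ∃ (C : ℝ) (p : ℕ), 0 < C ∧
      ∀ (T : ℕ) (L ε δ δTV : ℝ), 1 ≤ T → 1 ≤ L → 0 < ε → ε ≤ κ / T →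
        0 < δTV → δTV ≤ 1 → 0 < δ → δ ≤ c₀ * δTV → δ ≤ 1 / 2 →
        ∃ (H Nm : ℕ) (M δRS : ℝ), 1 ≤ H ∧ 1 ≤ Nm ∧ L * (1 + ε) < M ∧ M ≤ C * L ∧
          0 < δRS ∧ δRS < 1 ∧ δRS ≤ C * (δ / (T * Real.log (1 / δ))) ∧
          ∀ (S : ℕ → Type) (m : ReasoningModel S) (s₀ : S 0)
            (hL : m.RatioBound s₀ T L), m.BellmanBound s₀ T ε →
            (∀ r : (m.spgSMCMH s₀ Nm M δRS T H).Run,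
              ((m.spgSMCMH s₀ Nm M δRS T H).time r : ℝ) ≤
                C * (L * (T : ℝ) ^ 3 * Real.log (1 / δ) / δTV ^ 2) *
                  (1 + Real.log (T / δTV)) ^ p) ∧
            ∃ (E : Set (m.spgSMCMH s₀ Nm M δRS T H).Run)
              (hE : ∃ r ∈ E, r ∈ (m.spgSMCMH s₀ Nm M δRS T H).law.support),
              1 - δ ≤ prob (m.spgSMCMH s₀ Nm M δRS T H).law E ∧
              tvDist (m.target s₀ T hL)
                ((m.spgSMCMH s₀ Nm M δRS T H).outputGiven E hE) ≤ δTV := by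
  set β := Real.exp (-(2 * κ)) with hβ
  have hβ0 : 0 < β := Real.exp_pos _
  have hβ1 : β ≤ 1 := Real.exp_le_one_iff.2 (by linarith)
  set a₁ := 16 * (1 + κ) * (10 + 4 * κ) + 2 with ha₁
  set a₂ := 9216 * (1 + κ) / β ^ 2 + 1 with ha₂
  set C₀ := (1 / β + 2) * (7 * a₁ + 12 * a₂ + 36) with hC₀
  have ha₁0 : 0 < a₁ := by positivity
  have ha₂0 : 0 < a₂ := by positivity
  have hC₀0 : 0 < C₀ := by positivity
  -- `C₀` serves the time and `4 * (1 + κ)` the bound on `M = 4 * B`. Of the two logarithms, one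
  -- comes from the iterations and one from the trials.
  refine ⟨C₀ + 4 * (1 + κ), 2, by positivity, ?_⟩
  intro T L ε δ δTV hT hL1 hε0 hεκ hTV hTV1 hδ _ hδ2
  have hT' : (1 : ℝ) ≤ T := by exact_mod_cast hT
  have hTε : T * ε ≤ κ := by rwa [le_div_iff₀' (by linarith)] at hεκ
  have hεκ' : ε ≤ κ := (le_mul_of_one_le_left hε0.le hT').trans hTε
  set B := L * (1 + ε) with hB
  have hB0 : 0 < B := by positivity
  have hBκ : B ≤ L * (1 + κ) := by rw [hB]; gcongr
  have hΛ := half_le_log_inv hδ hδ2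
  have hX : 1 ≤ T / δTV := by rw [le_div_iff₀ hTV]; linarith
  have hℓ : 1 ≤ 1 + Real.log (T / δTV) := by linarith [Real.log_nonneg hX]
  have hδsq : δ ^ 2 ≤ 1 := pow_le_one₀ hδ.le (by linarith)
  -- One factor `δ` absorbs `log (1 / δ)` in the required bound on `δRS`. The factors `β * δTV / (4
  -- * T)` keep the total sampling error of a round below `β * δTV / 4`.
  set δRS := β * δ ^ 2 * δTV / (4 * T) with hδRS
  have hδRS0 : 0 < δRS := by positivity
  have hnum : β * δ ^ 2 * δTV ≤ δ ^ 2 := by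
    calc β * δ ^ 2 * δTV ≤ 1 * δ ^ 2 * 1 := by gcongr
      _ = δ ^ 2 := by ring
  have hδRS1 : δRS < 1 := by rw [hδRS, div_lt_one (by positivity)]; linarith
  set k := ⌈Real.log (2 / δTV) / β⌉₊ with hk
  -- Since `96 = 4 * 24`, the weight error `T * (24 * √(B / Nm))` is also at most `β * δTV / 4`.
  -- After division by `β` the two errors use `δTV / 2`, and the choice of `k` leaves `δTV / 2` for
  -- convergence of the chain.
  set Nm := ⌈B * (96 * T / (β * δTV)) ^ 2⌉₊ with hNm
  have hNmB : B ≤ Nm := by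
    refine le_trans (le_mul_of_one_le_right hB0.le (one_le_pow₀ ?_)) (Nat.le_ceil _)
    rw [one_le_div (by positivity)]
    nlinarith
  refine ⟨k + 1, Nm, 4 * B, δRS, by omega, Nat.ceil_pos.2 (by positivity), by linarith, ?_,
    hδRS0, hδRS1, ?_, ?_⟩
  · nlinarith
  · have hlog : δ * Real.log (1 / δ) ≤ 1 := by
      have := Real.log_le_sub_one_of_pos (x := 1 / δ) (by positivity)
      calc δ * Real.log (1 / δ) ≤ δ * (1 / δ) := by gcongr; linarith
        _ = 1 := mul_one_div_cancel hδ.ne'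
    have h1 : δRS ≤ δ / (T * Real.log (1 / δ)) := by
      rw [hδRS, div_le_div_iff₀ (by positivity) (by positivity)]
      calc β * δ ^ 2 * δTV * (T * Real.log (1 / δ)) ≤ δ ^ 2 * (T * Real.log (1 / δ)) := by gcongr
        _ = δ * T * (δ * Real.log (1 / δ)) := by ring
        _ ≤ δ * T * 4 := by gcongr; linarith
        _ = _ := by ring
    refine h1.trans (le_mul_of_one_le_left (by positivity) ?_)
    linarith
  intro S m s₀ hL hε
  constructor
  · intro r
    have h1 : ((m.spgSMCMH s₀ Nm (4 * B) δRS T (k + 1)).time r : ℝ) ≤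
        (((k + 1) * (T * (7 * ⌈4 * (4 * B) * Real.log (4 / δRS)⌉₊ + 6 * Nm + 12) + 6) : ℕ) : ℝ) :=
      Nat.cast_le.2 (m.timeLE_outerLoop s₀ Nm (4 * B) δRS T k r)
    refine (h1.trans (total_time_le hT hL1 hTV hTV1 hΛ hℓ ha₁0.le ha₂0.le
      (trials_le hκ hT hL1 hB0 hBκ hδ hδ2 hTV hTV1)
      (samples_le hT hL1 hB0 hBκ hβ0 hTV hTV1) (iterations_le hT hβ0 hTV hTV1))).trans ?_
    have : C₀ ≤ C₀ + 4 * (1 + κ) := by linarith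
    gcongr
  · refine ⟨Set.univ, ?_, ?_, ?_⟩
    · obtain ⟨r, hr⟩ := (m.spgSMCMH s₀ Nm (4 * B) δRS T (k + 1)).law.support_nonempty
      exact ⟨r, Set.mem_univ r, hr⟩
    · have : prob (m.spgSMCMH s₀ Nm (4 * B) δRS T (k + 1)).law Set.univ = 1 := by
        rw [prob, ← expect_indicator, Set.indicator_univ]
        exact (congrArg ENNReal.toReal (expect_const _ 1)).trans ENNReal.toReal_one
      rw [this]; linarith
    · rw [Prog.outputGiven_univ]
      refine Close.tvDist_le hTV.le (Close.symm ?_)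
      refine (ReasoningModel.close_outerLoop hL hε hL1 hε0 hκ hTε hNmB hδRS0 hδRS1 k).mono
        (ENNReal.ofReal_le_ofReal ?_)
      have h1 := one_sub_pow_ceil_le hβ0 hβ1 hTV
      have h2 := sqrt_div_ceil_le hT hB0 hβ0 hTV
      have h3 : T * δRS ≤ β * δTV / 4 := by
        calc T * δRS = β * δTV / 4 * δ ^ 2 := by rw [hδRS]; field_simp
          _ ≤ _ := mul_le_of_le_one_right (by positivity) hδsq
      have h4 : T * (24 * √(B / Nm)) ≤ β * δTV / 4 := by
        calc T * (24 * √(B / Nm)) ≤ T * (24 * (β * δTV / (96 * T))) := by gcongr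
          _ = _ := by field_simp; norm_num
      have h5 : (T * δRS + T * (24 * √(B / Nm))) / β ≤ δTV / 2 := by
        rw [div_le_iff₀ hβ0]; linarith
      linarith
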